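/- \textbf{Model.} A network is a finite connected graph whose edges have positive real lengths; at each node $v$ of degree $d$ the incident edges are attached to ports numbered $1,\dots,d$. A configuration $(T,A)$ consists of a network $T$ and a set $A$ of nodes; initially there is one agent at each node of $A$, holding its own piece of information. Agents start simultaneously and move along the edges at speed one; they may stop and wait at nodes and inside edges. Agents that are at the same point (a node or a point inside an edge) at the same time exchange all the information they hold. The power used by an agent is the total distance it travels. A \emph{centralized broadcast strategy} for $(T,A)$ with source agent $s\in A$ is a finite schedule of movements of the agents after which all agents hold the initial information of $s$; it uses power at most $P$ if every agent travels distance at most $P$. In a \emph{distributed algorithm} all agents are anonymous and execute the same deterministic algorithm, without any knowledge of the network, of their position, or of the other agents. An agent perceives the degree of the node at which it is and the port through which it entered it, measures the elapsed time and the distance it has travelled, and, when it meets other agents, learns everything that they know and the ports through which they entered the node. Let $d_T$ be the distance in $T$ and $$D(T,A)=\max_{\emptyset\subsetneq X\subsetneq A}\ \min_{x\in X,\ y\in A\setminus X} d_T(x,y)$$ (with $D(T,A)=0$ if $|A|=1$). \textbf{Statement.} There is a distributed algorithm such that, for every configuration $(T,A)$ in which $T$ is a tree and $A$ contains all the leaves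 of $T$, and for every source agent $s\in A$, its execution on $(T,A)$ terminates after finitely many events (all agents stand still forever), at its end all agents hold the initial information of $s$, and each agent has used power at most $2D(T,A)$. Moreover the algorithm is $4$-competitive: if there is a centralized broadcast strategy for $(T,A)$ with source agent $s$ that uses power at most $P$, then each agent has used power at most $4P$ in this execution. -/

import Mathlib

namespace MobileAgents

/-! ### Weighted networks with port numbers -/

/-- A weighted graph with vertex set `V`.  The ports at a node `v` of degree `d` are the integers
`1, …, d`; the edge from `v` to `u` is attached at `v` to the port `port v u`.  The values of `len`
and `port` on non-adjacent pairs play no role. -/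
structure Network (V : Type*) where
  graph : SimpleGraph V
  len : V → V → ℝ
  len_symm : ∀ u v, len u v = len v u
  len_pos : ∀ u v, graph.Adj u v → 0 < len u v
  port : V → V → ℕ
  port_bij : ∀ v, Set.BijOn (port v) (graph.neighborSet v)
    (Set.Icc 1 (graph.neighborSet v).ncard)

variable {V : Type*}

/-- The degree of a node. -/
noncomputable def Network.deg (N : Network V) (v : V) : ℕ := (N.graph.neighborSet v).ncard

/-- The total length of a walk. -/
def Network.walkLen (N : Network V) {u v : V} (p : N.graph.Walk u v) : ℝ :=
  (p.darts.map fun d => N.len d.fst d.snd).sum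

/-- The distance between two nodes of a weighted graph. -/
noncomputable def Network.dist (N : Network V) (u v : V) : ℝ :=
  ⨅ p : N.graph.Walk u v, N.walkLen p

/-- `D(G,A)`: the maximum, over all partitions of `A` into two non-empty parts `X` and `A \ X`, of
the minimum distance between the parts.  (It is `0` if `A` has no such partition.) -/
noncomputable def Network.sep (N : Network V) (A : Finset V) : ℝ :=
  sSup {r | ∃ X : Set V, X.Nonempty ∧ X ⊂ (A : Set V) ∧
    r = sInf {d | ∃ x ∈ X, ∃ y ∈ (A : Set V) \ X, d = N.dist x y}}

/-! ### Points of the network -/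

/-- Where an agent is, and where it is heading.
* `node v e`: it is at the node `v`, which it last entered through port `e` (`none` if it has
  been there from the beginning).
* `edge u v x h`: it is on the edge `uv`, at distance `x` from `u`; it left `u` towards `v` the
  last time it was at a node, and now it moves at speed one towards `v` if `h = 1`, moves at speed
  one towards `u` if `h = -1`, and stands still if `h = 0`. -/
inductive Place (V : Type*) where
  | node (v : V) (entry : Option ℕ)
  | edge (u v : V) (x : ℝ) (h : SignType)

/-- The place is the node `z` (endpoints of edges are nodes). -/
def Place.IsNode (N : Network V) : Place V → V → Prop
  | .node v _, z => v = z
  | .edge u v x _, z => (x = 0 ∧ u = z) ∨ (x = N.len u v ∧ v = z)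

/-- The place is the point of the edge `ab` at distance `y` from `a`. -/
def Place.IsOnEdge (N : Network V) : Place V → V → V → ℝ → Prop
  | .node _ _, _, _, _ => False
  | .edge u v x _, a, b, y => (u = a ∧ v = b ∧ x = y) ∨ (u = b ∧ v = a ∧ N.len u v - x = y)

/-- Two places are the same point of the network. -/
def Coincide (N : Network V) (p q : Place V) : Prop :=
  (∃ z, p.IsNode N z ∧ q.IsNode N z) ∨ ∃ a b y, p.IsOnEdge N a b y ∧ q.IsOnEdge N a b y

/-! ### Centralized strategies -/

/-- A movement along an edge `uv`, at speed one, from the point at distance `x` from `u` to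
the point at distance `y` from `u`. -/
structure Movement (V : Type*) where
  time : ℝ
  u : V
  v : V
  x : ℝ
  y : ℝ

/-- The length (and the duration) of a movement. -/
def Movement.cost (m : Movement V) : ℝ := |m.y - m.x|

/-- A finite sequence of movements that can be executed one after another by an agent that
is at `p` at time `τ`. -/
def IsRoute (N : Network V) : Place V → ℝ → List (Movement V) → Prop
  | _, _, [] => True
  | p, τ, m :: ms =>
      N.graph.Adj m.u m.v ∧ m.x ∈ Set.Icc 0 (N.len m.u m.v) ∧ m.y ∈ Set.Icc 0 (N.len m.u m.v) ∧
      Coincide N p (.edge m.u m.v m.x 0) ∧ τ ≤ m.time ∧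
      IsRoute N (.edge m.u m.v m.y 0) (m.time + m.cost) ms

/-- The place at time `t` of an agent that starts at `p` and executes the given movements. -/
noncomputable def position : Place V → List (Movement V) → ℝ → Place V
  | p, [], _ => p
  | p, m :: ms, t =>
      if t < m.time then p
      else if t ≤ m.time + m.cost then
        .edge m.u m.v (m.x + SignType.sign (m.y - m.x) * (t - m.time)) 0
      else position (.edge m.u m.v m.y 0) ms t

/-- The power used by an agent executing the given movements. -/
def routeCost (ms : List (Movement V)) : ℝ := (ms.map Movement.cost).sum

/-- In the strategy `S` agent `a` holds at time `t` the initial information of agent `s`.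
Agents exchange everything they hold whenever they are at the same point at the same time. -/
inductive Informed (N : Network V) {A : Finset V} (S : A → List (Movement V)) (s : A) :
    A → ℝ → Prop where
  | source (t : ℝ) (ht : 0 ≤ t) : Informed N S s s t
  | keep (a : A) (t t' : ℝ) (h : Informed N S s a t) (ht : t ≤ t') : Informed N S s a t'
  | meet (a b : A) (t : ℝ) (h : Informed N S s b t)
      (hm : Coincide N (position (.node (a : V) none) (S a) t)
        (position (.node (b : V) none) (S b) t)) :
      Informed N S s a t

/-- There is a (centralized) broadcast strategy for the configuration `(N, A)` with source agent `s`
in which each agent uses power at most `P`. -/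
def HasBroadcastStrategy (N : Network V) (A : Finset V) (s : A) (P : ℝ) : Prop :=
  ∃ S : A → List (Movement V),
    (∀ a : A, IsRoute N (.node (a : V) none) 0 (S a)) ∧ (∀ a, routeCost (S a) ≤ P) ∧
    ∀ a : A, ∃ t, Informed N S s a t

/-! ### Distributed algorithms -/

/-- The kind of place an agent perceives: a node, together with its degree and the port through
which the agent last entered it, or a point inside an edge. -/
inductive Spot where
  | node (deg : ℕ) (entry : Option ℕ)
  | edge

/-- What the sensors of an agent tell it: the kind of place, the time elapsed since the common
start, and the power that it has used so far. -/
structure Reading where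
  spot : Spot
  clock : ℝ
  used : ℝ

/-- Moves that an agent can decide on: stay where it is; at a node, leave through
a port; inside an edge, go away from (`forward`) or back to (`backward`) the node that it visited
last. -/
inductive Move where
  | stay
  | exit (port : ℕ)
  | forward
  | backward

/-- A deterministic algorithm, executed by all agents.  An agent is activated at the start, when it
reaches a node, when it meets other agents, and when its timer expires.  Knowing its memory, its
sensor readings, and the memory and readings of the other agents that are at the same point, it
then changes its memory, decides how to move until it is activated again, and sets its timer
(`none`, or a non-positive duration: no timer).  It has no access to the network, to its position,
or to the identities of the agents, and it is not told which agent is the source. -/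
structure Algorithm where
  Mem : Type
  start : Mem
  act : Mem → Reading → Multiset (Mem × Reading) → Mem × Move × Option ℝ

/-- The state of an agent. `known` is the set of (starting nodes of) agents whose initial
information it holds. -/
structure AgentState (V : Type*) (M : Type) where
  mem : M
  place : Place V
  timer : Option ℝ
  used : ℝ
  known : Set V

/-- The state of all agents at a given time. -/
structure World (A : Finset V) (M : Type) where
  time : ℝ
  agent : A → AgentState V M

/-- Agents stay at nodes; inside edges they keep moving with their velocity. -/
def Place.drift (δ : ℝ) : Place V → Place V
  | .node v e => .node v e
  | .edge u v x h => .edge u v (x + (h : ℝ) * δ) h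

/-- The speed of an agent, which is one or zero. -/
def Place.speed : Place V → ℝ
  | .node _ _ => 0
  | .edge _ _ _ h => |(h : ℝ)|

/-- A moving agent has come to the end of its edge. -/
def Place.Arrives (N : Network V) : Place V → Prop
  | .node _ _ => False
  | .edge u v x h => (h = 1 ∧ x = N.len u v) ∨ (h = -1 ∧ x = 0)

open Classical in
/-- An agent that has come to the end of its edge enters the node. -/
noncomputable def Place.land (N : Network V) : Place V → Place V
  | .node v e => .node v e
  | .edge u v x h =>
      if h = 1 ∧ x = N.len u v then .node v (some (N.port v u))
      else if h = -1 ∧ x = 0 then .node u (some (N.port u v))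
      else .edge u v x h

/-- The kind of place that an agent perceives. -/
noncomputable def Place.spot (N : Network V) : Place V → Spot
  | .node v e => .node (N.deg v) e
  | .edge _ _ _ _ => .edge

open Classical in
/-- The effect of a decision. Decisions that make no sense at the current place mean `stay`. -/
noncomputable def Place.obey (N : Network V) : Place V → Move → Place V
  | .node v e, .exit p =>
      if h : ∃ u, N.graph.Adj v u ∧ N.port v u = p then .edge v h.choose 0 1 else .node v e
  | .node v e, _ => .node v e
  | .edge u v x _, .forward => .edge u v x 1
  | .edge u v x _, .backward => .edge u v x (-1)
  | .edge u v x _, _ => .edge u v x 0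

variable {A : Finset V} {M : Type}

/-- What happens during `δ` units of time in which no agent changes its decision. -/
noncomputable def World.advance (N : Network V) (c : World A M) (δ : ℝ) : World A M where
  time := c.time + δ
  agent a :=
    { mem := (c.agent a).mem
      place := ((c.agent a).place.drift δ).land N
      timer := (c.agent a).timer.map (· - δ)
      used := (c.agent a).used + (c.agent a).place.speed * δ
      known := (c.agent a).known }

/-- After `δ` units of time agent `a` reaches a node, its timer expires, or it meets an agent. -/
def World.Triggered (N : Network V) (c : World A M) (δ : ℝ) (a : A) : Prop :=
  ((c.agent a).place.drift δ).Arrives N ∨ (c.agent a).timer = some δ ∨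
  ∃ b, ¬ Coincide N (c.agent a).place (c.agent b).place ∧
    Coincide N ((c.agent a).place.drift δ) ((c.agent b).place.drift δ)

/-- `δ` is the time until the next event. -/
def World.NextEvent (N : Network V) (c : World A M) (δ : ℝ) : Prop :=
  IsLeast {δ : ℝ | 0 < δ ∧ ∃ a, c.Triggered N δ a} δ

/-- The sensor readings of an agent. -/
noncomputable def World.reading (N : Network V) (c : World A M) (a : A) : Reading where
  spot := (c.agent a).place.spot N
  clock := c.time
  used := (c.agent a).used

open Classical in
/-- The memory and the readings of the agents that share the current point of `a`. -/
noncomputable def World.others (N : Network V) (c : World A M) (a : A) : Multiset (M × Reading) :=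
  (Finset.univ.filter fun b => b ≠ a ∧ Coincide N (c.agent a).place (c.agent b).place).val.map
    fun b => ((c.agent b).mem, c.reading N b)

open Classical in
/-- Agents at the same point exchange all the information that they hold, and the agents in `S`
execute the algorithm, simultaneously. -/
noncomputable def Algorithm.respond (alg : Algorithm) (N : Network V) (c : World A alg.Mem)
    (S : Set A) : World A alg.Mem where
  time := c.time
  agent a :=
    let known :=
      {x | ∃ b, Coincide N (c.agent a).place (c.agent b).place ∧ x ∈ (c.agent b).known}
    if a ∈ S then
      let r := alg.act (c.agent a).mem (c.reading N a) (c.others N a)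
      { mem := r.1
        place := (c.agent a).place.obey N r.2.1
        timer := r.2.2.filter fun τ => 0 < τ
        used := (c.agent a).used
        known := known }
    else { c.agent a with known := known }

/-- At time `0` all agents are at their starting nodes, and all of them are activated. -/
noncomputable def Algorithm.initial (alg : Algorithm) (N : Network V) (A : Finset V) :
    World A alg.Mem :=
  alg.respond N
    { time := 0
      agent := fun a =>
        { mem := alg.start, place := .node a none, timer := none, used := 0, known := {↑a} } }
    Set.univ

/-- One step of the execution: time advances to the next event, and all agents at the points where
something happens are activated.  All other agents notice nothing. -/
def Algorithm.Step (alg : Algorithm) (N : Network V) (c c' : World A alg.Mem) : Prop :=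
  ∃ δ, c.NextEvent N δ ∧
    c' = alg.respond N (c.advance N δ)
      {a | ∃ b, c.Triggered N δ b ∧
        Coincide N ((c.advance N δ).agent a).place ((c.advance N δ).agent b).place}

/-- All agents stand still and no timer is running: nothing will ever happen any more. -/
def World.Quiescent (c : World A M) : Prop :=
  ∀ a, (c.agent a).place.speed = 0 ∧ (c.agent a).timer = none

/-- The execution of `alg` on the configuration `(N, A)` (which is deterministic) ends in `c`. -/
def Algorithm.EndsIn (alg : Algorithm) (N : Network V) (c : World A alg.Mem) : Prop :=
  Relation.ReflTransGen (alg.Step N) (alg.initial N A) c ∧ c.Quiescent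

end MobileAgents

/-! Write D for `N.sep A`. The bound 4P follows from a lower bound D ≤ 2P for every centralized
strategy and an upper bound 2D for the algorithm.

Lower bound (`sep_le_two_mul`). An agent with power P stays within distance P of its start, so two
agents that meet start at distance at most 2P. If D > 2P, some cut of A has all its distances above
2P, and information never crosses it.

Upper bound. `gather` collects information from the leaves inwards. A node v "fires" towards w when
agents have arrived from all neighbours except w; among the agents at v the one with the least power
used leaves, and the others park. Inductively, an agent that came to v from u has used at most the
length of any walk to v from the start of any agent behind the edge uv. The least of these values,
or 0 if an agent starts at v, therefore bounds the trip of the departing agent so far by the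
distance of every agent behind vw. Since all leaves carry agents, the edge vw splits A into two
nonempty parts, so this trip plus the edge vw costs at most D (`add_len_le_sep`). Retracing the trip
doubles the cost: 2D. An agent that meets another one inside an edge goes on to the end of the edge
before it returns, which stays within the same 2D.

Correctness. As long as nothing has come together, some agent is moving (`exists_moving`), and each
arrival visits a node that is new for its agent; so after finitely many events a node is reached
from all sides or two carriers meet in an edge. At that moment every other node has fired and its
carrier has arrived, so all agents that are not parked are at one point (`turn_at_node`,
`turn_at_edge`), and they hold the information of the source, because some unparked agent always
holds it. They then walk home. An agent parked at v is woken at the latest by the agent that left v,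
whose way home passes through v; that agent may itself be parked, but only since a later time, so
waiting is acyclic (`rank`) and everybody gets home.

The invariants are `Collecting` (with `Pending` between events) and `Returning`. The maps `fire`,
`L`, `rank` and the remaining ways `t` are bookkeeping of the proof and invisible to the agents. -/

namespace MobileAgents

/-! ### The two sides of an edge of a tree -/

section Sides

variable {V : Type*} {G : SimpleGraph V} {u v w x y z : V}

/-- The nodes that remain connected to `u` when the edge `uw` is removed. -/
def side (G : SimpleGraph V) (u w : V) : Set V :=
  {x | (G.deleteEdges {s(u, w)}).Reachable x u}

lemma mem_side_self : u ∈ side G u w := SimpleGraph.Reachable.refl _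

lemma side_of_adj (hx : x ∈ side G u w) (h : G.Adj z x) (he : s(z, x) ≠ s(u, w)) :
    z ∈ side G u w :=
  SimpleGraph.Reachable.trans
    (SimpleGraph.Adj.reachable (SimpleGraph.deleteEdges_adj.2 ⟨h, he⟩)) hx

lemma notMem_side (hG : G.IsAcyclic) (h : G.Adj u w) : w ∉ side G u w := fun hw =>
  (SimpleGraph.isBridge_iff.1 (SimpleGraph.isAcyclic_iff_forall_adj_isBridge.1 hG h)) hw.symm

lemma side_disjoint (hG : G.IsAcyclic) (h : G.Adj u w) (hx : x ∈ side G u w) :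
    x ∉ side G w u := by
  intro hx'
  unfold side at hx hx'
  rw [Sym2.eq_swap] at hx'
  exact notMem_side hG h (SimpleGraph.Reachable.trans hx'.symm hx)

lemma side_cross (hx : x ∈ side G u w) (h : G.Adj x z)
    (hz : z ∉ side G u w) : x = u ∧ z = w := by
  by_contra hne
  refine hz (side_of_adj hx h.symm fun he => ?_)
  rcases Sym2.eq_iff.1 he with ⟨rfl, rfl⟩ | ⟨rfl, rfl⟩
  · exact hz mem_side_self
  · exact hne ⟨rfl, rfl⟩

/-- Follow a walk to u backwards: only a step over the edge uw itself can leave a side, and both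
endpoints of this edge lie on some side. -/
lemma side_total (hG : G.IsTree) (u w x : V) : x ∈ side G u w ∨ x ∈ side G w u := by
  obtain ⟨p⟩ := hG.connected.preconnected x u
  induction p with
  | nil => exact .inl mem_side_self
  | @cons a b c h p ih =>
    by_cases he : s(a, b) = s(c, w)
    · rcases Sym2.eq_iff.1 he with ⟨rfl, rfl⟩ | ⟨rfl, rfl⟩
      · exact .inl mem_side_self
      · exact .inr mem_side_self
    · refine ih.imp (fun hb => side_of_adj hb h he) fun hb => side_of_adj hb h ?_
      rwa [Sym2.eq_swap (a := w)]

/-- The node u is the neighbour of v through which a walk from x, avoiding the edge vw, enters v: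
the branches at v other than the one of w cover the side of v. -/
lemma exists_side_of_mem_side (hx : x ∈ side G v w) (hne : x ≠ v) :
    ∃ u, G.Adj u v ∧ u ≠ w ∧ x ∈ side G u v := by
  obtain ⟨p⟩ := hx
  generalize hH : G.deleteEdges {s(v, w)} = H at p
  induction p with
  | nil => exact absurd rfl hne
  | @cons a b c h p ih =>
    subst hH
    obtain ⟨hab, he⟩ := SimpleGraph.deleteEdges_adj.1 h
    by_cases hb : b = c
    · subst hb
      refine ⟨a, hab, ?_, mem_side_self⟩
      rintro rfl
      exact he Sym2.eq_swap
    · obtain ⟨u, hu, huw, hbu⟩ := ih hb rfl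
      refine ⟨u, hu, huw, ?_⟩
      by_contra ha
      exact hne (side_cross hbu hab.symm ha).2

/-- A walk that stays on the side of u never visits v, so it cannot use the edge vw either. -/
lemma side_subset (hG : G.IsAcyclic) (h : G.Adj u v) (huw : u ≠ w) :
    side G u v ⊆ side G v w := by
  rintro x ⟨p⟩
  generalize hH : G.deleteEdges {s(u, v)} = H at p
  induction p with
  | @nil a =>
    refine side_of_adj mem_side_self h fun he => ?_
    rcases Sym2.eq_iff.1 he with ⟨rfl, rfl⟩ | ⟨rfl, _⟩
    · exact h.ne rfl
    · exact huw rfl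
  | @cons a b c hab p ih =>
    subst hH
    have hb : b ∈ side G c v := ⟨p⟩
    have ha : a ∈ side G c v := ⟨.cons hab p⟩
    obtain ⟨hab', -⟩ := SimpleGraph.deleteEdges_adj.1 hab
    refine side_of_adj (ih h huw rfl) hab' fun he => ?_
    rcases Sym2.eq_iff.1 he with ⟨rfl, rfl⟩ | ⟨rfl, rfl⟩
    · exact notMem_side hG h ha
    · exact notMem_side hG h hb

/-- Induction over the darts of a finite tree, away from the leaves. -/
lemma dart_induction [Finite V] (hG : G.IsAcyclic) {P : V → V → Prop}
    (ind : ∀ v w, G.Adj v w → (∀ u, G.Adj u v → u ≠ w → P u v) → P v w) :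
    ∀ v w, G.Adj v w → P v w := by
  -- The measure is the size of the side of v, which shrinks strictly from vw to uv because v itself
  -- drops out.
  have key : ∀ n v w, (side G v w).ncard = n → G.Adj v w → P v w := by
    intro n
    induction n using Nat.strong_induction_on with
    | _ n ih =>
      intro v w hn h
      refine ind v w h fun u hu huw => ih _ ?_ u v rfl hu
      rw [← hn]
      refine Set.ncard_lt_ncard ?_ (Set.toFinite _)
      exact ⟨side_subset hG hu huw, fun hs => notMem_side hG hu (hs mem_side_self)⟩
  exact fun v w => key _ v w rfl

end Sides

/-! ### Lengths of walks, distances and the separation D(T,A) -/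

section Lengths

variable {V : Type*} {N : Network V} {A : Finset V} {u v w x y z : V}

lemma walkLen_nil : N.walkLen (.nil : N.graph.Walk u u) = 0 := by simp [Network.walkLen]

lemma walkLen_cons (h : N.graph.Adj u v) (p : N.graph.Walk v w) :
    N.walkLen (.cons h p) = N.len u v + N.walkLen p := by simp [Network.walkLen]

lemma walkLen_append (p : N.graph.Walk u v) (q : N.graph.Walk v w) :
    N.walkLen (p.append q) = N.walkLen p + N.walkLen q := by simp [Network.walkLen]

lemma walkLen_nonneg (p : N.graph.Walk u v) : 0 ≤ N.walkLen p := by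
  induction p with
  | nil => rw [walkLen_nil]
  | cons h p ih => rw [walkLen_cons]; linarith [N.len_pos _ _ h]

lemma walkLen_reverse (p : N.graph.Walk u v) : N.walkLen p.reverse = N.walkLen p := by
  induction p with
  | nil => rfl
  | cons h p ih =>
    rw [SimpleGraph.Walk.reverse_cons, walkLen_append, ih, walkLen_cons, walkLen_cons, walkLen_nil,
      N.len_symm]
    ring

lemma bddBelow_walkLen : BddBelow (Set.range fun p : N.graph.Walk u v => N.walkLen p) :=
  ⟨0, by rintro _ ⟨p, rfl⟩; exact walkLen_nonneg p⟩

lemma dist_le_walkLen (p : N.graph.Walk u v) : N.dist u v ≤ N.walkLen p :=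
  ciInf_le bddBelow_walkLen p

lemma dist_nonneg : 0 ≤ N.dist u v := Real.iInf_nonneg walkLen_nonneg

/-- Connectedness matters: the infimum over an empty family of walks would be 0 by convention. -/
lemma le_dist (hN : N.graph.Connected) {r : ℝ} (h : ∀ p : N.graph.Walk u v, r ≤ N.walkLen p) :
    r ≤ N.dist u v :=
  haveI : Nonempty (N.graph.Walk u v) := hN.preconnected u v
  le_ciInf h

lemma dist_comm : N.dist u v = N.dist v u := by
  have key : ∀ a b, N.dist a b = ⨅ p : N.graph.Walk b a, N.walkLen p := by
    intro a b
    unfold Network.dist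
    refine Function.Surjective.iInf_congr SimpleGraph.Walk.reverse (fun p => ⟨p.reverse, by simp⟩) ?_
    exact walkLen_reverse
  exact key u v

lemma dist_self : N.dist u u = 0 :=
  le_antisymm ((dist_le_walkLen .nil).trans_eq walkLen_nil) dist_nonneg

lemma dist_adj (h : N.graph.Adj u v) : N.dist u v ≤ N.len u v := by
  simpa [walkLen_cons, walkLen_nil] using dist_le_walkLen (N := N) (.cons h .nil)

lemma dist_triangle (hN : N.graph.Connected) : N.dist u w ≤ N.dist u v + N.dist v w := by
  rw [← sub_le_iff_le_add]
  refine le_dist hN fun p => ?_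
  rw [sub_le_comm]
  refine le_dist hN fun q => ?_
  rw [sub_le_iff_le_add, add_comm, ← walkLen_append]
  exact dist_le_walkLen _

/-- A walk that leaves a side of an edge traverses this edge. -/
lemma exists_walk_to_side (p : N.graph.Walk x y) (hx : x ∈ side N.graph u w) (hy : y ∉ side N.graph u w) :
    ∃ q : N.graph.Walk x u, N.walkLen q + N.len u w ≤ N.walkLen p := by
  induction p with
  | nil => exact absurd hx hy
  | @cons a b c h p ih =>
    by_cases hb : b ∈ side N.graph u w
    · obtain ⟨q, hq⟩ := ih hb hy
      exact ⟨.cons h q, by rw [walkLen_cons, walkLen_cons]; linarith⟩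
    · obtain ⟨rfl, rfl⟩ := side_cross hx h hb
      exact ⟨.nil, by rw [walkLen_cons, walkLen_nil]; linarith [walkLen_nonneg p]⟩

/-- If all leaves carry agents then there are agents on both sides of every edge. -/
lemma exists_agent_side [Finite V] (hN : N.graph.IsTree) (hA : ∀ v, N.deg v = 1 → v ∈ A) :
    ∀ v w, N.graph.Adj v w → ∃ x ∈ A, x ∈ side N.graph v w := by
  refine dart_induction hN.isAcyclic fun v w h ih => ?_
  by_cases hd : N.deg v = 1
  · exact ⟨v, hA v hd, mem_side_self⟩
  · have : ∃ u, N.graph.Adj u v ∧ u ≠ w := by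
      by_contra! hu
      refine hd ?_
      unfold Network.deg
      rw [Set.ncard_eq_one]
      exact ⟨w, Set.eq_singleton_iff_unique_mem.2 ⟨h, fun u hvu => hu u hvu.symm⟩⟩
    obtain ⟨u, hu, huw⟩ := this
    obtain ⟨x, hx, hxu⟩ := ih u hu huw
    exact ⟨x, hx, side_subset hN.isAcyclic hu huw hxu⟩

/-- A finite V has finitely many subsets X, so the supremum that defines `sep` is over a bounded set
and dominates each cut. -/
lemma le_sep [Finite V] {X : Set V} {r : ℝ} (hX : X.Nonempty) (hXA : X ⊂ (A : Set V))
    (h : ∀ x ∈ X, ∀ y ∈ (A : Set V) \ X, r ≤ N.dist x y) : r ≤ N.sep A := by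
  obtain ⟨y, hy, hyX⟩ := Set.exists_of_ssubset hXA
  obtain ⟨x, hx⟩ := hX
  have hle : r ≤ sInf {d | ∃ x ∈ X, ∃ y ∈ (A : Set V) \ X, d = N.dist x y} := by
    refine le_csInf ⟨_, x, hx, y, ⟨hy, hyX⟩, rfl⟩ ?_
    rintro _ ⟨x, hx, y, hy, rfl⟩
    exact h x hx y hy
  refine hle.trans (le_csSup (Set.Finite.bddAbove ?_) ⟨X, ⟨x, hx⟩, hXA, rfl⟩)
  refine (Set.toFinite (Set.range fun X : Set V =>
    sInf {d | ∃ x ∈ X, ∃ y ∈ (A : Set V) \ X, d = N.dist x y})).subset ?_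
  rintro _ ⟨X, -, -, rfl⟩
  exact ⟨X, rfl⟩

lemma sep_nonneg : 0 ≤ N.sep A := by
  refine Real.sSup_nonneg ?_
  rintro _ ⟨X, -, -, rfl⟩
  refine Real.sInf_nonneg ?_
  rintro _ ⟨x, -, y, -, rfl⟩
  exact dist_nonneg

/-- The nearest agent behind an edge can traverse it with power `D(T,A)`. -/
lemma add_len_le_sep [Finite V] (hN : N.graph.IsTree) (hA : ∀ v, N.deg v = 1 → v ∈ A)
    (h : N.graph.Adj u w) {r : ℝ}
    (hr : ∀ x ∈ A, x ∈ side N.graph u w → ∀ p : N.graph.Walk x u, r ≤ N.walkLen p) :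
    r + N.len u w ≤ N.sep A := by
  obtain ⟨x, hxA, hx⟩ := exists_agent_side hN hA u w h
  obtain ⟨y, hyA, hy⟩ := exists_agent_side hN hA w u h.symm
  -- The cut consists of the agents behind the edge uw and the remaining ones; any walk across it
  -- goes to u and then traverses uw.
  refine le_sep (X := {x | x ∈ A ∧ x ∈ side N.graph u w}) ⟨x, hxA, hx⟩
    ⟨fun x hx => hx.1, fun hs => side_disjoint hN.isAcyclic h (hs hyA).2 hy⟩ ?_
  rintro x ⟨hxA, hx⟩ y ⟨hyA, hy⟩
  refine le_dist hN.connected fun p => ?_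
  obtain ⟨q, hq⟩ := exists_walk_to_side p hx fun hy' => hy ⟨hyA, hy'⟩
  linarith [hr x hxA hx q]

end Lengths

/-! ### Centralized strategies need half of `D(T,A)` -/

section LowerBound

variable {V : Type*} {N : Network V} {A : Finset V} {a b u v w z : V} {p q : Place V}
  {x y r r' : ℝ}

/-- The place is at distance at most `r` from the node `a`. -/
def Within (N : Network V) (a : V) (r : ℝ) : Place V → Prop
  | .node z _ => N.dist a z ≤ r
  | .edge u w x _ => N.graph.Adj u w ∧ 0 ≤ x ∧ x ≤ N.len u w ∧
      (N.dist a u + x ≤ r ∨ N.dist a w + (N.len u w - x) ≤ r)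

lemma Within.of_isNode (hN : N.graph.Connected) (h : Within N a r p) (hz : p.IsNode N z) :
    N.dist a z ≤ r := by
  cases p with
  | node v e => obtain rfl := hz; exact h
  | edge u w x k =>
    obtain ⟨hadj, h0, h1, h⟩ := h
    rcases hz with ⟨rfl, rfl⟩ | ⟨rfl, rfl⟩
    · rcases h with h | h
      · linarith
      · have := dist_triangle hN (u := a) (v := w) (w := u)
        have := dist_adj hadj.symm
        rw [N.len_symm] at this
        linarith
    · rcases h with h | h
      · have := dist_triangle hN (u := a) (v := u) (w := w)
        have := dist_adj hadj
        linarith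
      · linarith

lemma Within.of_isOnEdge (h : Within N a r p) (hz : p.IsOnEdge N u w x) :
    N.graph.Adj u w ∧ 0 ≤ x ∧ x ≤ N.len u w ∧
      (N.dist a u + x ≤ r ∨ N.dist a w + (N.len u w - x) ≤ r) := by
  cases p with
  | node v e => exact hz.elim
  | edge u' w' x' k =>
    obtain ⟨hadj, h0, h1, h⟩ := h
    rcases hz with ⟨rfl, rfl, rfl⟩ | ⟨rfl, rfl, rfl⟩
    · exact ⟨hadj, h0, h1, h⟩
    · rw [N.len_symm w' u']
      refine ⟨hadj.symm, by linarith, by linarith, ?_⟩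
      rcases h with h | h
      · right; linarith
      · left; linarith

/-- The critical case is a common point inside an edge that the two bounds reach through different
endpoints; the two parts of the edge then add up to its length, which is at least the distance of
the endpoints. -/
lemma Within.dist_le (hN : N.graph.Connected) (hp : Within N a r p) (hq : Within N b r' q)
    (h : Coincide N p q) : N.dist a b ≤ r + r' := by
  rcases h with ⟨z, hz, hz'⟩ | ⟨u, w, y, hz, hz'⟩
  · have h1 := hp.of_isNode hN hz
    have h2 := hq.of_isNode hN hz'
    rw [dist_comm] at h2
    linarith [dist_triangle hN (u := a) (v := z) (w := b)]
  · obtain ⟨hadj, h0, hl, h1⟩ := hp.of_isOnEdge hz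
    obtain ⟨-, -, -, h2⟩ := hq.of_isOnEdge hz'
    rw [dist_comm (u := b), dist_comm (u := b)] at h2
    have hau := dist_triangle hN (u := a) (v := u) (w := b)
    have haw := dist_triangle hN (u := a) (v := w) (w := b)
    have huw := dist_triangle hN (u := u) (v := w) (w := b)
    have hwu := dist_triangle hN (u := w) (v := u) (w := b)
    have hd := dist_adj hadj
    have hd' := hd
    rw [dist_comm] at hd'
    rcases h1 with h1 | h1 <;> rcases h2 with h2 | h2 <;> linarith

lemma Within.mono (h : Within N a r p) (hr : r ≤ r') : Within N a r' p := by
  cases p with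
  | node v e => exact h.trans hr
  | edge u w x k =>
    obtain ⟨hadj, h0, h1, h⟩ := h
    exact ⟨hadj, h0, h1, h.imp (fun h => h.trans hr) fun h => h.trans hr⟩

/-- A point has several descriptions (a node, or a position on either orientation of an edge); the
bound survives the change of description that `IsRoute` allows between consecutive movements. -/
lemma Within.of_coincide (hN : N.graph.Connected) {k : SignType} (h : Within N a r p)
    (huw : N.graph.Adj u w) (h0 : 0 ≤ x) (h1 : x ≤ N.len u w)
    (hc : Coincide N p (.edge u w x k)) : Within N a r (.edge u w x k) := by
  refine ⟨huw, h0, h1, ?_⟩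
  rcases hc with ⟨z, hz, hz'⟩ | ⟨b, c, y, hz, hz'⟩
  · have := h.of_isNode hN hz
    rcases hz' with ⟨rfl, rfl⟩ | ⟨rfl, rfl⟩
    · left; linarith
    · right; linarith
  · obtain ⟨-, -, -, h'⟩ := h.of_isOnEdge hz
    rcases hz' with ⟨rfl, rfl, rfl⟩ | ⟨rfl, rfl, rfl⟩
    · exact h'
    · rw [N.len_symm w u] at *
      rcases h' with h | h
      · right; linarith
      · left; linarith

lemma Within.move {k k' : SignType} (h : Within N a r (.edge u w x k)) (h0 : 0 ≤ y)
    (h1 : y ≤ N.len u w) (hr : r + |y - x| ≤ r') : Within N a r' (.edge u w y k') := by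
  obtain ⟨hadj, -, -, h⟩ := h
  refine ⟨hadj, h0, h1, ?_⟩
  have := le_abs_self (y - x)
  have := neg_abs_le (y - x)
  rcases h with h | h
  · left; linarith
  · right; linarith

lemma routeCost_nonneg (ms : List (Movement V)) : 0 ≤ routeCost ms := by
  refine List.sum_nonneg fun c hc => ?_
  obtain ⟨m, -, rfl⟩ := List.mem_map.1 hc
  exact abs_nonneg _

/-- Each movement enlarges the radius by its cost; partial movements cost no more than complete
ones. Place, time and radius are generalized for the induction over the route. -/
lemma Within.position (hN : N.graph.Connected) (ms : List (Movement V)) (t : ℝ) :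
    ∀ (p : Place V) (τ r : ℝ), IsRoute N p τ ms → Within N a r p →
      Within N a (r + routeCost ms) (position p ms t) := by
  induction ms with
  | nil => intro p τ r _ h; simpa [routeCost, MobileAgents.position] using h
  | cons m ms ih =>
    rintro p τ r ⟨hadj, hx, hy, hc, -, hroute⟩ h
    have hcost : routeCost (m :: ms) = |m.y - m.x| + routeCost ms := by
      simp [routeCost, Movement.cost]
    have hms := routeCost_nonneg ms
    have hstart := h.of_coincide hN hadj hx.1 hx.2 hc
    rw [MobileAgents.position, hcost]
    split_ifs with h1 h2
    · exact h.mono (by linarith [abs_nonneg (m.y - m.x)])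
    · rw [Movement.cost] at h2
      obtain ⟨hx0, hx1⟩ := hx
      obtain ⟨hy0, hy1⟩ := hy
      rcases lt_trichotomy (m.y - m.x) 0 with hs | hs | hs
      · rw [abs_of_neg hs] at *
        rw [sign_neg hs]
        refine hstart.move ?_ ?_ ?_
        · simp; linarith
        · simp; linarith
        · rw [abs_of_nonpos] <;> simp <;> linarith
      · rw [hs] at *
        rw [abs_zero] at *
        rw [sign_zero]
        refine hstart.move ?_ ?_ ?_ <;> simp <;> linarith
      · rw [abs_of_pos hs] at *
        rw [sign_pos hs]
        refine hstart.move ?_ ?_ ?_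
        · simp; linarith
        · simp; linarith
        · rw [abs_of_nonneg] <;> simp <;> linarith
    · rw [← add_assoc]
      exact ih _ _ _ hroute (hstart.move hy.1 hy.2 le_rfl)

lemma Coincide.symm (h : Coincide N p q) : Coincide N q p :=
  h.imp (fun ⟨z, h1, h2⟩ => ⟨z, h2, h1⟩) fun ⟨a, b, y, h1, h2⟩ => ⟨a, b, y, h2, h1⟩

/-- Agents that meet start at distance at most 2P, so information cannot cross a cut whose distances
all exceed 2P. -/
theorem sep_le_two_mul (hN : N.graph.Connected) {s : A} {P : ℝ}
    (h : HasBroadcastStrategy N A s P) : N.sep A ≤ 2 * P := by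
  obtain ⟨S, hroute, hcost, hinf⟩ := h
  have hP : 0 ≤ P := (routeCost_nonneg _).trans (hcost s)
  have hmeet : ∀ (a b : A) (t : ℝ), Coincide N (position (.node (a : V) none) (S a) t)
      (position (.node (b : V) none) (S b) t) → N.dist a b ≤ 2 * P := by
    intro a b t hc
    have hw : ∀ a : A, Within N (a : V) (0 + routeCost (S a))
        (position (.node (a : V) none) (S a) t) := fun a =>
      Within.position hN _ t _ 0 0 (hroute a) (dist_self (N := N)).le
    linarith [(hw a).dist_le hN (hw b) hc, hcost a, hcost b]
  -- Nonnegativity of 2P covers the case without a partition, where the supremum is 0 by convention.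
  refine Real.sSup_le ?_ (by linarith)
  rintro _ ⟨X, ⟨x, hx⟩, hXA, rfl⟩
  obtain ⟨y, hy, hyX⟩ := Set.exists_of_ssubset hXA
  have hbdd : BddBelow {d | ∃ x ∈ X, ∃ y ∈ (A : Set V) \ X, d = N.dist x y} :=
    ⟨0, by rintro _ ⟨x, -, y, -, rfl⟩; exact dist_nonneg⟩
  by_contra! hlt
  have hfar : ∀ a ∈ X, ∀ b ∈ (A : Set V) \ X, 2 * P < N.dist a b := fun a ha b hb =>
    hlt.trans_le (csInf_le hbdd ⟨a, ha, b, hb, rfl⟩)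
  -- Invariant: informed agents are on the same side of the cut as the source. Applied to one agent
  -- from each side, this is contradictory.
  have hside : ∀ (a : A) (t : ℝ), Informed N S s a t → ((a : V) ∈ X ↔ (s : V) ∈ X) := by
    intro a t hat
    induction hat with
    | source => rfl
    | keep a t t' _ _ ih => exact ih
    | meet a b t _ hm ih =>
      rw [← ih]
      have h1 := hmeet a b t hm
      by_contra hne
      by_cases ha : (a : V) ∈ X
      · exact absurd h1 (hfar a ha b ⟨b.2, fun hb => hne ⟨fun _ => hb, fun _ => ha⟩⟩).not_ge
      · have hb : (b : V) ∈ X := by tauto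
        rw [dist_comm] at h1
        exact absurd h1 (hfar b hb a ⟨a.2, ha⟩).not_ge
  obtain ⟨t, ht⟩ := hinf ⟨x, hXA.1 hx⟩
  obtain ⟨t', ht'⟩ := hinf ⟨y, hy⟩
  exact hyX ((hside _ _ ht').2 ((hside _ _ ht).1 hx))

end LowerBound

/-! ### Events of executions in which moving agents never turn inside edges -/

section Events

variable {V : Type*} {N : Network V} {A : Finset V} {M : Type} {c : World A M} {u v w u' v' w' : V}
  {e e' : Option ℕ} {x y δ : ℝ} {h k : SignType} {p q : Place V}

lemma coincide_refl (p : Place V) : Coincide N p p := by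
  cases p with
  | node v e => exact .inl ⟨v, rfl, rfl⟩
  | edge u w x k => exact .inr ⟨u, w, x, .inl ⟨rfl, rfl, rfl⟩, .inl ⟨rfl, rfl, rfl⟩⟩

lemma coincide_node_iff : Coincide N (.node v e) (.node v' e') ↔ v = v' := by
  constructor
  · rintro (⟨z, rfl, rfl⟩ | ⟨a, b, y, hf, -⟩)
    · rfl
    · exact hf.elim
  · rintro rfl
    exact .inl ⟨v, rfl, rfl⟩

lemma not_coincide_node_edge (h0 : 0 < x) (h1 : x < N.len u w) :
    ¬ Coincide N (.node v e) (.edge u w x h) := by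
  rintro (⟨z, -, ⟨rfl, -⟩ | ⟨rfl, -⟩⟩ | ⟨a, b, y, hf, -⟩)
  · exact h0.ne rfl
  · exact h1.ne rfl
  · exact hf.elim

lemma coincide_edge (hx0 : 0 < x) (hx1 : x < N.len u w)
    (hc : Coincide N (.edge u w x h) (.edge u' w' y k)) :
    (u = u' ∧ w = w' ∧ x = y) ∨ (u = w' ∧ w = u' ∧ x + y = N.len u w) := by
  rcases hc with ⟨z, ⟨rfl, -⟩ | ⟨rfl, -⟩, -⟩ | ⟨a, b, z, h1, h2⟩
  · exact (hx0.ne rfl).elim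
  · exact (hx1.ne rfl).elim
  · rcases h1 with ⟨rfl, rfl, rfl⟩ | ⟨rfl, rfl, rfl⟩ <;>
      rcases h2 with ⟨rfl, rfl, h2⟩ | ⟨rfl, rfl, h2⟩
    · exact .inl ⟨rfl, rfl, h2.symm⟩
    · refine .inr ⟨rfl, rfl, ?_⟩
      rw [← h2, N.len_symm]
      ring
    · exact .inr ⟨rfl, rfl, by rw [h2]; ring⟩
    · exact .inl ⟨rfl, rfl, by linarith⟩

lemma coincide_edge_opposite (hxy : x + y = N.len u w) :
    Coincide N (.edge u w x h) (.edge w u y k) :=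
  .inr ⟨u, w, x, .inl ⟨rfl, rfl, rfl⟩, .inr ⟨rfl, rfl, by rw [N.len_symm, ← hxy]; ring⟩⟩

lemma not_coincide_edge_opposite (huw : u ≠ w) (hx : 0 ≤ x) (hy : 0 ≤ y)
    (hxy : x + y < N.len u w) : ¬ Coincide N (.edge u w x h) (.edge w u y k) := by
  rintro (⟨z, h1, h2⟩ | ⟨a, b, z, h1, h2⟩)
  · rcases h1 with ⟨rfl, rfl⟩ | ⟨rfl, rfl⟩
    · rcases h2 with ⟨-, rfl⟩ | ⟨rfl, -⟩
      · exact huw rfl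
      · rw [N.len_symm w] at hxy
        linarith
    · linarith
  · rcases h1 with ⟨rfl, rfl, rfl⟩ | ⟨rfl, rfl, rfl⟩ <;>
      rcases h2 with ⟨h2, -, h2'⟩ | ⟨h2, -, h2'⟩
    · exact huw h2.symm
    · rw [N.len_symm w] at h2'
      linarith
    · linarith
    · exact huw h2.symm

/-- The agent is at a node or moves away from the node that it visited last. -/
def Place.Regular (N : Network V) : Place V → Prop
  | .node _ _ => True
  | .edge u w x h => N.graph.Adj u w ∧ h = 1 ∧ 0 ≤ x ∧ x < N.len u w

/-- No timers are running and no agent has turned inside an edge. -/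
def World.Regular (N : Network V) (c : World A M) : Prop :=
  ∀ a, (c.agent a).timer = none ∧ (c.agent a).place.Regular N

lemma drift_edge : (Place.edge u w x 1).drift δ = .edge u w (x + δ) 1 := by
  simp [Place.drift]

/-- All moving agents have speed one, so agents with the same direction in an edge keep their
distance. A new coincidence is therefore at the end of an edge or between agents that face each
other. -/
lemma meet_cases (hp : p.Regular N) (hq : q.Regular N) (hδ : 0 < δ) (h : ¬ Coincide N p q)
    (h' : Coincide N (p.drift δ) (q.drift δ)) :
    (∃ u w x, p = .edge u w x 1 ∧ x + δ = N.len u w) ∨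
    (∃ u w x, q = .edge u w x 1 ∧ x + δ = N.len u w) ∨
    ∃ u w x y, p = .edge u w x 1 ∧ q = .edge w u y 1 ∧ x + y + 2 * δ = N.len u w := by
  cases p with
  | node v e =>
    cases q with
    | node v' e' => exact absurd h' h
    | edge u w x k =>
      obtain ⟨-, rfl, h0, -⟩ := hq
      rw [drift_edge] at h'
      rcases h' with ⟨z, -, ⟨h1, -⟩ | ⟨h1, -⟩⟩ | ⟨a, b, y, hf, -⟩
      · linarith
      · exact .inr (.inl ⟨u, w, x, rfl, h1⟩)
      · exact hf.elim
  | edge u w x k =>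
    obtain ⟨-, rfl, h0, -⟩ := hp
    rw [drift_edge] at h'
    cases q with
    | node v' e' =>
      rcases h' with ⟨z, ⟨h1, -⟩ | ⟨h1, -⟩, -⟩ | ⟨a, b, y, -, hf⟩
      · linarith
      · exact .inl ⟨u, w, x, rfl, h1⟩
      · exact hf.elim
    | edge u' w' y k =>
      obtain ⟨-, rfl, h0', -⟩ := hq
      rw [drift_edge] at h'
      rcases h' with ⟨z, ⟨h1, -⟩ | ⟨h1, -⟩, -⟩ | ⟨a, b, z, h1, h2⟩
      · linarith
      · exact .inl ⟨u, w, x, rfl, h1⟩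
      · rcases h1 with ⟨rfl, rfl, rfl⟩ | ⟨rfl, rfl, rfl⟩ <;>
          rcases h2 with ⟨rfl, rfl, h2⟩ | ⟨rfl, rfl, h2⟩
        · exact absurd (.inr ⟨_, _, x, .inl ⟨rfl, rfl, rfl⟩, .inl ⟨rfl, rfl, by linarith⟩⟩) h
        · rw [N.len_symm] at h2
          exact .inr (.inr ⟨_, _, x, y, rfl, rfl, by linarith⟩)
        · exact .inr (.inr ⟨_, _, x, y, rfl, rfl, by linarith⟩)
        · exact absurd (.inr ⟨_, _, x, .inl ⟨rfl, rfl, rfl⟩, .inl ⟨rfl, rfl, by linarith⟩⟩) h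

lemma trigger_cases (hc : c.Regular N) (hδ : 0 < δ) {a : A} (h : c.Triggered N δ a) :
    (∃ b u w x, (c.agent b).place = .edge u w x 1 ∧ x + δ = N.len u w) ∨
    ∃ b u w x y, (c.agent a).place = .edge u w x 1 ∧ (c.agent b).place = .edge w u y 1 ∧
      x + y + 2 * δ = N.len u w := by
  rcases h with h | h | ⟨b, h1, h2⟩
  · left
    cases hp : (c.agent a).place with
    | node v e => rw [hp] at h; exact h.elim
    | edge u w x k =>
      obtain ⟨-, rfl, -, -⟩ := hp ▸ (hc a).2
      rw [hp, drift_edge] at h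
      rcases h with ⟨-, h⟩ | ⟨h, -⟩
      · exact ⟨a, u, w, x, hp, h⟩
      · exact absurd h (by decide)
  · rw [(hc a).1] at h
    exact absurd h (by simp)
  · rcases meet_cases (hc a).2 (hc b).2 hδ h1 h2 with ⟨u, w, x, h, h'⟩ | ⟨u, w, x, h, h'⟩ |
      ⟨u, w, x, y, h, h', h''⟩
    · exact .inl ⟨a, u, w, x, h, h'⟩
    · exact .inl ⟨b, u, w, x, h, h'⟩
    · exact .inr ⟨b, u, w, x, y, h, h', h''⟩

lemma triggered_of_arrival {a : A} (h : (c.agent a).place = .edge u w x 1)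
    (hx : x + δ = N.len u w) : c.Triggered N δ a := by
  left
  rw [h, drift_edge]
  exact .inl ⟨rfl, hx⟩

lemma triggered_of_meet {a b : A} (huw : u ≠ w) (ha : (c.agent a).place = .edge u w x 1)
    (hb : (c.agent b).place = .edge w u y 1) (hx : 0 ≤ x) (hy : 0 ≤ y)
    (hxy : x + y < N.len u w) (hδ : x + y + 2 * δ = N.len u w) :
    c.Triggered N δ a ∧ c.Triggered N δ b := by
  have h1 := not_coincide_edge_opposite (h := 1) (k := 1) huw hx hy hxy
  have h2 : Coincide N (.edge u w (x + δ) 1) (.edge w u (y + δ) 1) :=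
    coincide_edge_opposite (by linarith)
  refine ⟨.inr (.inr ⟨b, ?_, ?_⟩), .inr (.inr ⟨a, ?_, ?_⟩)⟩
  · rwa [ha, hb]
  · rwa [ha, hb, drift_edge, drift_edge]
  · rw [ha, hb]
    exact fun h => h1 h.symm
  · rw [ha, hb, drift_edge, drift_edge]
    exact h2.symm

/-- Only finitely many times are possible: the remaining length of an edge for one agent, or half
the gap between two agents. A moving agent makes this set nonempty. -/
lemma exists_nextEvent (hc : c.Regular N) {a : A} (h : (c.agent a).place = .edge u w x 1) :
    ∃ δ, c.NextEvent N δ := by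
  let gap : Place V → ℝ
    | .node _ _ => 0
    | .edge u w x _ => N.len u w - x
  let gap' : Place V → Place V → ℝ
    | .edge u w x _, .edge _ _ y _ => (N.len u w - x - y) / 2
    | _, _ => 0
  set T : Set ℝ := {δ : ℝ | 0 < δ ∧ ∃ a, c.Triggered N δ a}
  have hfin : T.Finite := by
    refine (((Set.finite_range fun a => gap (c.agent a).place).union
      (Set.finite_range fun ab : A × A =>
        gap' (c.agent ab.1).place (c.agent ab.2).place))).subset ?_
    rintro δ ⟨hδ, a, ha⟩
    rcases trigger_cases hc hδ ha with ⟨b, u, w, x, hb, hx⟩ | ⟨b, u, w, x, y, ha, hb, hx⟩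
    · left
      refine ⟨b, ?_⟩
      simp only [hb, gap]
      linarith
    · right
      refine ⟨(a, b), ?_⟩
      simp only [ha, hb, gap']
      linarith
  have hne : T.Nonempty := by
    have hr := (hc a).2
    rw [h] at hr
    exact ⟨N.len u w - x, by linarith [hr.2.2.2], a, triggered_of_arrival h (by ring)⟩
  obtain ⟨δ, hδ, hmin⟩ := hfin.exists_minimal hne
  exact ⟨δ, hδ, fun δ' hδ' => (le_total δ δ').elim id fun hle => hmin hδ' hle⟩

lemma nextEvent_le_len (hc : c.Regular N) (hδ : c.NextEvent N δ) {a : A}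
    (h : (c.agent a).place = .edge u w x 1) : x + δ ≤ N.len u w := by
  have hr := (hc a).2
  rw [h] at hr
  have := hδ.2 ⟨sub_pos.2 hr.2.2.2, a, triggered_of_arrival h (add_sub_cancel _ _)⟩
  linarith

lemma nextEvent_le_meet (hc : c.Regular N) (hδ : c.NextEvent N δ) {a b : A}
    (ha : (c.agent a).place = .edge u w x 1) (hb : (c.agent b).place = .edge w u y 1)
    (hxy : x + y < N.len u w) : x + y + 2 * δ ≤ N.len u w := by
  have hra := (hc a).2
  have hrb := (hc b).2
  rw [ha] at hra
  rw [hb] at hrb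
  have := hδ.2 ⟨by linarith, a, (triggered_of_meet (δ := (N.len u w - x - y) / 2) hra.1.ne ha hb
    hra.2.2.1 hrb.2.2.1 hxy (by ring)).1⟩
  linarith

lemma place_advance_node {a : A} (h : (c.agent a).place = .node v e) :
    ((c.advance N δ).agent a).place = .node v e := by
  simp [World.advance, h, Place.drift, Place.land]

lemma place_advance_edge {a : A} (h : (c.agent a).place = .edge u w x 1)
    (hx : x + δ ≠ N.len u w) : ((c.advance N δ).agent a).place = .edge u w (x + δ) 1 := by
  simp only [World.advance, h, drift_edge, Place.land]
  rw [if_neg (fun h => hx h.2), if_neg (fun h => absurd h.1 (by decide))]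

lemma place_advance_arrival {a : A} (h : (c.agent a).place = .edge u w x 1)
    (hx : x + δ = N.len u w) :
    ((c.advance N δ).agent a).place = .node w (some (N.port w u)) := by
  simp only [World.advance, h, drift_edge, Place.land]
  simp [hx]

lemma used_advance_node {a : A} (h : (c.agent a).place = .node v e) :
    ((c.advance N δ).agent a).used = (c.agent a).used := by
  simp [World.advance, h, Place.speed]

lemma used_advance_edge {a : A} (h : (c.agent a).place = .edge u w x 1) :
    ((c.advance N δ).agent a).used = (c.agent a).used + δ := by
  simp [World.advance, h, Place.speed]

lemma timer_advance {a : A} (h : (c.agent a).timer = none) :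
    ((c.advance N δ).agent a).timer = none := by
  simp [World.advance, h]

/-- The agent is at a node or strictly inside an edge, moving away from the node that it visited
last. -/
def Place.Settled (N : Network V) : Place V → Prop
  | .node _ _ => True
  | .edge u w x h => N.graph.Adj u w ∧ h = 1 ∧ 0 < x ∧ x < N.len u w

/-- As δ is positive, an agent that was at offset 0 has left its node, and one that completes its
edge has been moved into the node. Coincidence with an agent at a node then means being at the same
node. -/
lemma settled_advance (hc : c.Regular N) (hδ : c.NextEvent N δ) (a : A) :
    ((c.advance N δ).agent a).place.Settled N := by
  cases hp : (c.agent a).place with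
  | node v e => rw [place_advance_node hp]; trivial
  | edge u w x k =>
    have hr := (hc a).2
    rw [hp] at hr
    obtain ⟨hadj, rfl, h0, h1⟩ := hr
    have hle := nextEvent_le_len hc hδ hp
    by_cases hx : x + δ = N.len u w
    · rw [place_advance_arrival hp hx]; trivial
    · rw [place_advance_edge hp hx]
      exact ⟨hadj, rfl, by linarith [hδ.1.1], lt_of_le_of_ne hle hx⟩

/-- The event is an arrival or a meeting of agents that move in opposite directions. -/
lemma nextEvent_cases (hc : c.Regular N) (hδ : c.NextEvent N δ) :
    (∃ b u w x, (c.agent b).place = .edge u w x 1 ∧ x + δ = N.len u w) ∨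
    ∃ a b u w x y, (c.agent a).place = .edge u w x 1 ∧ (c.agent b).place = .edge w u y 1 ∧
      x + y + 2 * δ = N.len u w := by
  obtain ⟨hpos, a, ha⟩ := hδ.1
  exact (trigger_cases hc hpos ha).imp id fun ⟨b, u, w, x, y, h⟩ => ⟨a, b, u, w, x, y, h⟩

/-- The agents that are activated after `δ` units of time. -/
def World.activated (N : Network V) (c : World A M) (δ : ℝ) : Set A :=
  {a | ∃ b, c.Triggered N δ b ∧
    Coincide N ((c.advance N δ).agent a).place ((c.advance N δ).agent b).place}

lemma mem_activated_of_arrival {a b : A} (h : (c.agent b).place = .edge u w x 1)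
    (hx : x + δ = N.len u w) (ha : ((c.advance N δ).agent a).place = .node w e) :
    a ∈ c.activated N δ := by
  refine ⟨b, triggered_of_arrival h hx, ?_⟩
  rw [ha, place_advance_arrival h hx]
  exact coincide_node_iff.2 rfl

lemma mem_activated {a : A} (h : c.Triggered N δ a) : a ∈ c.activated N δ :=
  ⟨a, h, coincide_refl _⟩

end Events

/-! ### The algorithm -/

/-- What an agent is doing: it collects information (`front`), it has passed its information on to
another agent and waits for that agent to come back (`parked`), it has met another agent inside an
edge and goes to the end of this edge (`met`), or it is on the way home or at home (`back`). -/
inductive Phase where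
  | front
  | parked
  | met
  | back

/-- The agents that know everything. -/
def Phase.Homebound : Phase → Prop
  | .front => False
  | .parked => False
  | .met => True
  | .back => True

/-- The memory of an agent: its phase, and the ports that lead home from the node that it visited
last (for phase `back`: from the node to which it is moving). -/
structure Memory where
  phase : Phase
  trail : List ℕ

/-- The port through which an agent at a node entered. -/
def Spot.entry : Spot → Option ℕ
  | .node _ e => e
  | .edge => none

/-- The ports of the way home of an agent at a node that was entered through the port `e`. -/
def Memory.path (m : Memory) (e : Option ℕ) : List ℕ :=
  match m.phase with
  | .back => m.trail
  | _ => e.toList ++ m.trail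

/-- Take the next step of the way home. -/
def homeward : List ℕ → Memory × Move × Option ℝ
  | [] => (⟨.back, []⟩, .stay, none)
  | p :: l => (⟨.back, l⟩, .exit p, none)

/-- Agents are compared by the power used so far; ties are broken by the port of entry. -/
noncomputable def Reading.key (r : Reading) : ℝ ×ₗ ℕ := toLex (r.used, r.spot.entry.getD 0)

/-- The ports of a node of degree `d` through which none of the present agents has entered. -/
def missingPorts (d : ℕ) (present : Multiset (Memory × Reading)) : Set ℕ :=
  {p | p ∈ Set.Icc 1 d ∧ ∀ o ∈ present, o.2.spot.entry ≠ some p}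

open Classical in
/-- Every agent waits until agents have come through all ports but one of its node; then the agent
with the least power used leaves through the last port.  When agents from all sides have
met at a node, or two agents inside an edge, they turn back, and all agents go home. -/
noncomputable abbrev gather : Algorithm where
  Mem := Memory
  start := ⟨.front, []⟩
  act m r others :=
    match r.spot with
    | .edge => (if m.phase = .front ∧ others ≠ 0 then ⟨.met, m.trail⟩ else m, .forward, none)
    | .node d e =>
      if (∃ o ∈ (m, r) ::ₘ others, o.1.phase.Homebound) ∨
          (m.phase = .front ∧ missingPorts d ((m, r) ::ₘ others) = ∅) then
        homeward (m.path e)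
      else if m.phase = .front then
        if h : ∃ p, missingPorts d ((m, r) ::ₘ others) = {p} then
          if ∀ o ∈ others, r.key ≤ o.2.key then (⟨.front, m.path e⟩, .exit h.choose, none)
          else (⟨.parked, m.trail⟩, .stay, none)
        else (m, .stay, none)
      else (m, .stay, none)

/-! ### The effect of one activation of `gather`, case by case -/

section Act

variable {V : Type*} {N : Network V} {A : Finset V} {c : World A Memory} {S : Set A} {a b : A}
  {u v w : V} {e : Option ℕ} {x : ℝ} {l : List V}

/-- The information available at the point of `a`. -/
def World.knownAt (N : Network V) (c : World A Memory) (a : A) : Set V :=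
  {x | ∃ b, Coincide N (c.agent a).place (c.agent b).place ∧ x ∈ (c.agent b).known}

/-- The execution of the algorithm by the agents in `S`. -/
noncomputable def World.next (N : Network V) (c : World A Memory) (S : Set A) :
    World A Memory :=
  gather.respond N c S

lemma known_next : ((c.next N S).agent a).known = c.knownAt N a := by
  by_cases h : a ∈ S <;> simp only [World.next, Algorithm.respond, h, World.knownAt] <;> rfl

lemma used_next : ((c.next N S).agent a).used = (c.agent a).used := by
  by_cases h : a ∈ S <;> simp [World.next, Algorithm.respond, h]

lemma mem_next (h : a ∈ S) : ((c.next N S).agent a).mem =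
    (gather.act (c.agent a).mem (c.reading N a) (c.others N a)).1 := by
  simp [World.next, Algorithm.respond, h]

lemma place_next (h : a ∈ S) : ((c.next N S).agent a).place = (c.agent a).place.obey N
    (gather.act (c.agent a).mem (c.reading N a) (c.others N a)).2.1 := by
  simp [World.next, Algorithm.respond, h]

lemma next_of_notMem (h : a ∉ S) : ((c.next N S).agent a).mem = (c.agent a).mem ∧
    ((c.next N S).agent a).place = (c.agent a).place := by
  simp [World.next, Algorithm.respond, h]

lemma timer_homeward (l : List ℕ) : (homeward l).2.2 = none := by
  cases l <;> rfl

lemma timer_act (m : Memory) (r : Reading) (o : Multiset (Memory × Reading)) :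
    (gather.act m r o).2.2 = none := by
  simp only [gather]
  split
  · rfl
  · split_ifs <;> first | rfl | exact timer_homeward _

lemma timer_next (h : (c.agent a).timer = none) : ((c.next N S).agent a).timer = none := by
  by_cases hS : a ∈ S
  · simp only [World.next, Algorithm.respond, hS, if_true]
    rw [timer_act]
    rfl
  · simp [World.next, Algorithm.respond, hS, h]

lemma mem_others {o : Memory × Reading} : o ∈ c.others N a ↔
    ∃ b, b ≠ a ∧ Coincide N (c.agent a).place (c.agent b).place ∧
      o = ((c.agent b).mem, c.reading N b) := by
  simp only [World.others, Multiset.mem_map, Finset.mem_val, Finset.mem_filter, Finset.mem_univ,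
    true_and, and_assoc, eq_comm]

lemma mem_present {o : Memory × Reading} :
    o ∈ ((c.agent a).mem, c.reading N a) ::ₘ c.others N a ↔
      ∃ b, Coincide N (c.agent a).place (c.agent b).place ∧
        o = ((c.agent b).mem, c.reading N b) := by
  rw [Multiset.mem_cons, mem_others]
  constructor
  · rintro (rfl | ⟨b, -, h⟩)
    · exact ⟨a, coincide_refl _, rfl⟩
    · exact ⟨b, h⟩
  · rintro ⟨b, h⟩
    by_cases hb : b = a
    · subst hb
      exact .inl h.2
    · exact .inr ⟨b, hb, h⟩

/-- The ports of `v` through which no agent at the point of `a` has entered. -/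
def World.missing (N : Network V) (c : World A Memory) (a : A) (v : V) : Set ℕ :=
  {p | p ∈ Set.Icc 1 (N.deg v) ∧ ∀ b, Coincide N (c.agent a).place (c.agent b).place →
    ((c.agent b).place.spot N).entry ≠ some p}

lemma missingPorts_present : missingPorts (N.deg v) (((c.agent a).mem, c.reading N a) ::ₘ
    c.others N a) = c.missing N a v := by
  ext p
  simp only [missingPorts, World.missing, Set.mem_ofPred_eq, mem_present]
  refine and_congr_right fun _ => ⟨fun h b hb => h _ ⟨b, hb, rfl⟩, ?_⟩
  rintro h _ ⟨b, hb, rfl⟩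
  exact h b hb

/-- Some agent at the point of `a` knows everything. -/
def World.HomeboundAt (N : Network V) (c : World A Memory) (a : A) : Prop :=
  ∃ b, Coincide N (c.agent a).place (c.agent b).place ∧ (c.agent b).mem.phase.Homebound

lemma exists_homebound : (∃ o ∈ ((c.agent a).mem, c.reading N a) ::ₘ c.others N a,
    o.1.phase.Homebound) ↔ c.HomeboundAt N a := by
  simp only [mem_present, World.HomeboundAt]
  constructor
  · rintro ⟨_, ⟨b, hb, rfl⟩, h⟩
    exact ⟨b, hb, h⟩
  · rintro ⟨b, hb, h⟩
    exact ⟨_, ⟨b, hb, rfl⟩, h⟩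

lemma reading_spot (h : (c.agent a).place = .node v e) :
    (c.reading N a).spot = .node (N.deg v) e := by
  simp [World.reading, h, Place.spot]

open Classical in
lemma act_node (h : (c.agent a).place = .node v e) :
    gather.act (c.agent a).mem (c.reading N a) (c.others N a) =
      if c.HomeboundAt N a ∨ ((c.agent a).mem.phase = .front ∧ c.missing N a v = ∅) then
        homeward ((c.agent a).mem.path e)
      else if (c.agent a).mem.phase = .front then
        if h : ∃ p, c.missing N a v = {p} then
          if ∀ o ∈ c.others N a, (c.reading N a).key ≤ o.2.key then
            (⟨.front, (c.agent a).mem.path e⟩, .exit h.choose, none)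
          else (⟨.parked, (c.agent a).mem.trail⟩, .stay, none)
        else ((c.agent a).mem, .stay, none)
      else ((c.agent a).mem, .stay, none) := by
  have hs := reading_spot (N := N) h
  simp only [gather, hs]
  simp only [missingPorts_present, exists_homebound]

lemma obey_stay : (Place.node v e).obey N .stay = .node v e := rfl

/-- Parked agents wait for agents that know everything. -/
lemma next_parked (h : (c.agent a).place = .node v e) (hp : (c.agent a).mem.phase = .parked)
    (hh : ¬ c.HomeboundAt N a) : ((c.next N S).agent a).mem = (c.agent a).mem ∧
      ((c.next N S).agent a).place = .node v e := by
  by_cases hS : a ∈ S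
  · rw [mem_next hS, place_next hS, act_node h, h]
    simp [hp, hh, obey_stay]
  · rw [← h]
    exact next_of_notMem hS

lemma next_front_wait (h : (c.agent a).place = .node v e) (hh : ¬ c.HomeboundAt N a)
    (h0 : c.missing N a v ≠ ∅) (h1 : ¬ ∃ p, c.missing N a v = {p}) :
    ((c.next N S).agent a).mem = (c.agent a).mem ∧
      ((c.next N S).agent a).place = .node v e := by
  by_cases hS : a ∈ S
  · rw [mem_next hS, place_next hS, act_node h, h]
    simp [hh, h0, h1, obey_stay]
  · rw [← h]
    exact next_of_notMem hS

lemma next_front_park (hS : a ∈ S) (h : (c.agent a).place = .node v e)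
    (hf : (c.agent a).mem.phase = .front) (hh : ¬ c.HomeboundAt N a)
    (h1 : ∃ p, c.missing N a v = {p})
    (hk : ¬ ∀ o ∈ c.others N a, (c.reading N a).key ≤ o.2.key) :
    ((c.next N S).agent a).mem = ⟨.parked, (c.agent a).mem.trail⟩ ∧
      ((c.next N S).agent a).place = .node v e := by
  have h0 : c.missing N a v ≠ ∅ := by
    obtain ⟨p, hp⟩ := h1
    rw [hp]
    exact Set.singleton_ne_empty p
  rw [mem_next hS, place_next hS, act_node h, h]
  rw [if_neg (by tauto), if_pos hf, dif_pos h1, if_neg hk]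
  exact ⟨rfl, rfl⟩

lemma port_inj (h : N.graph.Adj v u) (h' : N.graph.Adj v w) (hp : N.port v u = N.port v w) :
    u = w := (N.port_bij v).injOn h h' hp

lemma obey_exit (h : N.graph.Adj v u) :
    (Place.node v e).obey N (.exit (N.port v u)) = .edge v u 0 1 := by
  have hex : ∃ u', N.graph.Adj v u' ∧ N.port v u' = N.port v u := ⟨u, h, rfl⟩
  simp only [Place.obey]
  rw [dif_pos hex, port_inj hex.choose_spec.1 h hex.choose_spec.2]

lemma next_front_exit (hS : a ∈ S) (h : (c.agent a).place = .node v e)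
    (hf : (c.agent a).mem.phase = .front) (hh : ¬ c.HomeboundAt N a)
    (hu : N.graph.Adj v u) (h1 : c.missing N a v = {N.port v u})
    (hk : ∀ o ∈ c.others N a, (c.reading N a).key ≤ o.2.key) :
    ((c.next N S).agent a).mem = ⟨.front, e.toList ++ (c.agent a).mem.trail⟩ ∧
      ((c.next N S).agent a).place = .edge v u 0 1 := by
  have h0 : c.missing N a v ≠ ∅ := by
    rw [h1]
    exact Set.singleton_ne_empty _
  have hex : ∃ p, c.missing N a v = {p} := ⟨_, h1⟩
  have hch : hex.choose = N.port v u :=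
    (Set.singleton_injective (h1.symm.trans hex.choose_spec)).symm
  rw [mem_next hS, place_next hS, act_node h, h]
  rw [if_neg (by tauto), if_pos hf, dif_pos hex, if_pos hk]
  refine ⟨?_, ?_⟩
  · simp [Memory.path, hf]
  · simp only [hch]
    exact obey_exit hu

lemma reading_spot_edge {k : SignType} (h : (c.agent a).place = .edge u w x k) :
    (c.reading N a).spot = .edge := by
  simp [World.reading, h, Place.spot]

lemma next_edge (h : (c.agent a).place = .edge u w x 1)
    (hb : (c.agent a).mem.phase = .front →
      ∀ b, Coincide N (c.agent a).place (c.agent b).place → b = a) :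
    ((c.next N S).agent a).mem = (c.agent a).mem ∧
      ((c.next N S).agent a).place = .edge u w x 1 := by
  by_cases hS : a ∈ S
  · have ho : ¬ ((c.agent a).mem.phase = .front ∧ c.others N a ≠ 0) := by
      rintro ⟨hf, ho⟩
      obtain ⟨o, ho⟩ := Multiset.exists_mem_of_ne_zero ho
      obtain ⟨b, hne, hc, -⟩ := mem_others.1 ho
      exact hne (hb hf b hc)
    rw [mem_next hS, place_next hS, h]
    simp only [gather, reading_spot_edge h]
    rw [if_neg ho]
    exact ⟨rfl, rfl⟩
  · rw [← h]
    exact next_of_notMem hS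

lemma next_edge_meet (hS : a ∈ S) (h : (c.agent a).place = .edge u w x 1)
    (hf : (c.agent a).mem.phase = .front) (hne : b ≠ a)
    (hb : Coincide N (c.agent a).place (c.agent b).place) :
    ((c.next N S).agent a).mem = ⟨.met, (c.agent a).mem.trail⟩ ∧
      ((c.next N S).agent a).place = .edge u w x 1 := by
  have ho : c.others N a ≠ 0 := fun h0 => by
    have := mem_others.2 ⟨b, hne, hb, rfl⟩
    rw [h0] at this
    exact Multiset.notMem_zero _ this
  rw [mem_next hS, place_next hS, h]
  simp only [gather, reading_spot_edge h]
  rw [if_pos ⟨hf, ho⟩]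
  exact ⟨rfl, rfl⟩

/-! ### Ways through the network -/

/-- The ports through which a way leaves its nodes. -/
def Network.exits (N : Network V) : List V → List ℕ
  | u :: v :: l => N.port u v :: N.exits (v :: l)
  | _ => []

/-- The length of a way. -/
noncomputable def Network.wayLen (N : Network V) : List V → ℝ
  | u :: v :: l => N.len u v + N.wayLen (v :: l)
  | _ => 0

lemma exits_cons : N.exits (v :: l) = (l.head?.map (N.port v)).toList ++ N.exits l := by
  cases l <;> simp [Network.exits]

/-- The agent sets out on its way home. -/
lemma next_homeward (hS : a ∈ S) (h : (c.agent a).place = .node v e)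
    (hh : c.HomeboundAt N a ∨ ((c.agent a).mem.phase = .front ∧ c.missing N a v = ∅))
    (hp : (c.agent a).mem.path e = N.exits (v :: l)) (hl : (v :: l).IsChain N.graph.Adj) :
    ((c.next N S).agent a).mem = ⟨.back, N.exits l⟩ ∧
      ((l = [] ∧ ((c.next N S).agent a).place = .node v e) ∨
      ∃ u l', l = u :: l' ∧ ((c.next N S).agent a).place = .edge v u 0 1) := by
  rw [mem_next hS, place_next hS, act_node h, h, if_pos hh, hp]
  cases l with
  | nil => exact ⟨rfl, .inl ⟨rfl, rfl⟩⟩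
  | cons u l => exact ⟨rfl, .inr ⟨u, l, rfl, obey_exit (List.isChain_cons_cons.1 hl).1⟩⟩

lemma next_of_back_home (h : (c.agent a).place = .node v e)
    (hm : (c.agent a).mem = ⟨.back, []⟩) : ((c.next N S).agent a).mem = ⟨.back, []⟩ ∧
      ((c.next N S).agent a).place = .node v e := by
  by_cases hS : a ∈ S
  · have hh : c.HomeboundAt N a := ⟨a, coincide_refl _, by rw [hm]; trivial⟩
    rw [mem_next hS, place_next hS, act_node h, h, if_pos (.inl hh), hm]
    exact ⟨rfl, rfl⟩
  · rw [← h, ← hm]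
    exact next_of_notMem hS

end Act

/-! ### Going home -/

section Return

variable {V : Type*} {N : Network V} {A : Finset V} {c : World A Memory} {S : Set A} {a b : A}
  {u v w s : V} {e : Option ℕ} {x B δ : ℝ} {l : List V} {g : AgentState V Memory}
  {t : A → List V} {rank : A → ℕ}

/-- The agent is parked, and its way home goes through the nodes in `l`. -/
def IsParked (N : Network V) (B : ℝ) (g : AgentState V Memory) (l : List V) : Prop :=
  ∃ v e tr, g.mem = ⟨.parked, tr⟩ ∧ g.place = .node v e ∧ (v :: l).IsChain N.graph.Adj ∧
    e.toList ++ tr = N.exits (v :: l) ∧ g.used + N.wayLen (v :: l) ≤ B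

/-- The agent knows everything, and it goes home through the nodes in `l`. -/
def IsHoming (N : Network V) (B : ℝ) (s : V) (g : AgentState V Memory) (l : List V) : Prop :=
  ∃ u w x r tr, g.place = .edge u w x 1 ∧ N.graph.Adj u w ∧ 0 ≤ x ∧ x < N.len u w ∧ l = w :: r ∧
    (w :: r).IsChain N.graph.Adj ∧ g.used + (N.len u w - x) + N.wayLen (w :: r) ≤ B ∧
    s ∈ g.known ∧ ((g.mem = ⟨.back, tr⟩ ∧ tr = N.exits (w :: r)) ∨
      (g.mem = ⟨.met, tr⟩ ∧ N.port w u :: tr = N.exits (w :: r)))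

/-- The agent knows everything and is at home. -/
def IsHome (B : ℝ) (s : V) (g : AgentState V Memory) (l : List V) : Prop :=
  ∃ v e, g.place = .node v e ∧ g.mem = ⟨.back, []⟩ ∧ l = [] ∧ g.used ≤ B ∧ s ∈ g.known

/-- All agents know everything, or wait for an agent that knows everything.  The list `t a`
contains the nodes that agent `a` is yet to visit. -/
structure Returning (N : Network V) (B : ℝ) (s : V) (c : World A Memory) (t : A → List V)
    (rank : A → ℕ) : Prop where
  timer : ∀ a, (c.agent a).timer = none
  state : ∀ a, IsParked N B (c.agent a) (t a) ∨ IsHoming N B s (c.agent a) (t a) ∨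
    IsHome B s (c.agent a) (t a)
  wait : ∀ a v e, (c.agent a).place = .node v e → (c.agent a).mem.phase = .parked →
    ∃ b, rank a < rank b ∧ v ∈ t b

lemma IsParked.phase (h : IsParked N B g l) : g.mem.phase = .parked := by
  obtain ⟨v, e, tr, hm, -⟩ := h
  rw [hm]

lemma IsHoming.phase (h : IsHoming N B s g l) : g.mem.phase ≠ .parked ∧ g.mem.phase ≠ .front := by
  obtain ⟨u, w, x, r, tr, -, -, -, -, -, -, -, -, ⟨hm, -⟩ | ⟨hm, -⟩⟩ := h <;> rw [hm] <;>
    exact ⟨by simp, by simp⟩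

lemma IsHoming.homebound (h : IsHoming N B s g l) : g.mem.phase.Homebound := by
  obtain ⟨u, w, x, r, tr, -, -, -, -, -, -, -, -, ⟨hm, -⟩ | ⟨hm, -⟩⟩ := h <;> rw [hm] <;>
    exact trivial

lemma IsHome.phase (h : IsHome B s g l) : g.mem.phase ≠ .parked := by
  obtain ⟨v, e, -, hm, -⟩ := h
  rw [hm]
  simp

lemma Returning.regular (h : Returning N B s c t rank) : c.Regular N := by
  refine fun a => ⟨h.timer a, ?_⟩
  rcases h.state a with ⟨v, e, tr, -, hp, -⟩ | ⟨u, w, x, r, tr, hp, hadj, h0, h1, -⟩ |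
    ⟨v, e, hp, -⟩
  · rw [hp]; trivial
  · rw [hp]; exact ⟨hadj, rfl, h0, h1⟩
  · rw [hp]; trivial

lemma Returning.mem_known (h : Returning N B s c t rank)
    (hb : (c.agent b).mem.phase.Homebound) : s ∈ (c.agent b).known := by
  rcases h.state b with hs | hs | hs
  · rw [hs.phase] at hb
    exact hb.elim
  · obtain ⟨u, w, x, r, tr, -, -, -, -, -, -, -, hk, -⟩ := hs
    exact hk
  · obtain ⟨v, e, -, -, -, -, hk⟩ := hs
    exact hk

lemma mem_known_next (h : s ∈ (c.agent a).known) : s ∈ ((c.next N S).agent a).known := by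
  rw [known_next]
  exact ⟨a, coincide_refl _, h⟩

/-- An agent that sets out on its way home is on the way home, or already there. -/
lemma homing_or_home (hS : a ∈ S) (h : (c.agent a).place = .node v e)
    (hh : c.HomeboundAt N a ∨ ((c.agent a).mem.phase = .front ∧ c.missing N a v = ∅))
    (hp : (c.agent a).mem.path e = N.exits (v :: l)) (hl : (v :: l).IsChain N.graph.Adj)
    (hu : (c.agent a).used + N.wayLen (v :: l) ≤ B) (hs : s ∈ c.knownAt N a) :
    IsHoming N B s ((c.next N S).agent a) l ∨ IsHome B s ((c.next N S).agent a) l := by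
  obtain ⟨hm, ⟨rfl, hp'⟩ | ⟨u, l', rfl, hp'⟩⟩ := next_homeward hS h hh hp hl
  · refine .inr ⟨v, e, hp', hm, rfl, ?_, by rwa [known_next]⟩
    rw [used_next]
    simpa [Network.wayLen] using hu
  · obtain ⟨hadj, hl'⟩ := List.isChain_cons_cons.1 hl
    refine .inl ⟨v, u, 0, l', _, hp', hadj, le_rfl, N.len_pos _ _ hadj, rfl, hl', ?_,
      by rwa [known_next], .inl ⟨hm, rfl⟩⟩
    rw [used_next]
    rw [Network.wayLen] at hu
    linarith

open Classical in
/-- The remaining work of an agent. -/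
noncomputable def workload (g : AgentState V Memory) (l : List V) : ℕ :=
  2 * l.length + if g.mem.phase = .parked then 1 else 0

lemma workload_congr {g' : AgentState V Memory} (h : g'.mem = g.mem) :
    workload g' l = workload g l := by
  rw [workload, workload, h]

lemma workload_lt_of_parked (h : IsParked N B g l) {g' : AgentState V Memory}
    (h' : IsHoming N B s g' l ∨ IsHome B s g' l) : workload g' l < workload g l := by
  have hp : g'.mem.phase ≠ .parked := by
    rcases h' with h' | h'
    · exact h'.phase.1
    · exact h'.phase
  simp [workload, h.phase, hp]

/-- The four facts that `Returning.step` combines over all agents: a parked agent stays parked only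
if it was not woken; a node disappears from a way only when all agents there are activated together
with an agent that knows everything; the workload never grows and drops at arrivals; if it does not
drop, the agent just drifts. -/
lemma Returning.agent_step (h : Returning N B s c t rank) (hδ : c.NextEvent N δ) (a : A) :
    ∃ l, (IsParked N B (((c.advance N δ).next N (c.activated N δ)).agent a) l ∨
        IsHoming N B s (((c.advance N δ).next N (c.activated N δ)).agent a) l ∨
        IsHome B s (((c.advance N δ).next N (c.activated N δ)).agent a) l) ∧
      (IsParked N B (((c.advance N δ).next N (c.activated N δ)).agent a) l →
        (c.agent a).mem.phase = .parked ∧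
          (((c.advance N δ).next N (c.activated N δ)).agent a).place = (c.agent a).place ∧
          ¬ (a ∈ c.activated N δ ∧ (c.advance N δ).HomeboundAt N a)) ∧
      (∀ v ∈ t a, v ∈ l ∨ ∀ b e, ((c.advance N δ).agent b).place = .node v e →
        b ∈ c.activated N δ ∧ (c.advance N δ).HomeboundAt N b) ∧
      workload (((c.advance N δ).next N (c.activated N δ)).agent a) l ≤
        workload (c.agent a) (t a) ∧
      ((∃ u w x, (c.agent a).place = .edge u w x 1 ∧ x + δ = N.len u w) →
        workload (((c.advance N δ).next N (c.activated N δ)).agent a) l <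
          workload (c.agent a) (t a)) ∧
      (workload (((c.advance N δ).next N (c.activated N δ)).agent a) l =
        workload (c.agent a) (t a) →
        (((c.advance N δ).next N (c.activated N δ)).agent a).place =
          (c.agent a).place.drift δ) := by
  rcases h.state a with hs | hs | hs
  · have hs0 := hs
    obtain ⟨v, e, tr, hm, hp, hl, htr, hu⟩ := hs
    have hp1 := place_advance_node (N := N) (δ := δ) hp
    by_cases hh : a ∈ c.activated N δ ∧ (c.advance N δ).HomeboundAt N a
    · have hhome := homing_or_home (B := B) (s := s) hh.1 hp1 (.inl hh.2)
        (l := t a) (by simpa [World.advance, Memory.path, hm] using htr) hl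
        (by rwa [used_advance_node hp]) (by
          obtain ⟨b, hb, hb'⟩ := hh.2
          exact ⟨b, hb, h.mem_known hb'⟩)
      have hlt := workload_lt_of_parked hs0 hhome
      refine ⟨t a, .inr hhome, fun hpk => ?_, fun v hv => .inl hv, hlt.le, fun _ => hlt,
        fun heq => absurd heq hlt.ne⟩
      rcases hhome with hhome | hhome
      · exact absurd hpk.phase hhome.phase.1
      · exact absurd hpk.phase hhome.phase
    · obtain ⟨hm', hp'⟩ : (((c.advance N δ).next N (c.activated N δ)).agent a).mem =
          (c.agent a).mem ∧
          (((c.advance N δ).next N (c.activated N δ)).agent a).place = .node v e := by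
        by_cases ha : a ∈ c.activated N δ
        · exact next_parked hp1 hs0.phase fun hb => hh ⟨ha, hb⟩
        · rw [← hp1]
          exact next_of_notMem ha
      have hw : workload (((c.advance N δ).next N (c.activated N δ)).agent a) (t a) =
          workload (c.agent a) (t a) := workload_congr hm'
      refine ⟨t a, .inl ⟨v, e, tr, hm'.trans hm, hp', hl, htr, ?_⟩,
        fun _ => ⟨hs0.phase, hp'.trans hp.symm, hh⟩, fun v hv => .inl hv, hw.le, ?_, fun _ => ?_⟩
      · rwa [used_next, used_advance_node hp]
      · rintro ⟨u, w, x, hp2, -⟩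
        rw [hp] at hp2
        simp at hp2
      · rw [hp', hp, Place.drift]
  · have hs0 := hs
    obtain ⟨u, w, x, r, tr, hp, hadj, h0, h1, ht, hl, hu, hk, hm⟩ := hs
    by_cases hx : x + δ = N.len u w
    · have hp1 := place_advance_arrival hp hx
      have hhb : (c.advance N δ).HomeboundAt N a := ⟨a, coincide_refl _, hs0.homebound⟩
      have hS := mem_activated_of_arrival hp hx hp1
      have hhome := homing_or_home (B := B) (s := s) hS hp1 (.inl hhb)
        -- In phase `back` the trail already starts at w; in phase `met` the entry port, which leads
        -- back over the edge just traversed, is still to be prepended.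
        (l := r) (by
          rcases hm with ⟨hm, rfl⟩ | ⟨hm, htr⟩
          · simp [World.advance, Memory.path, hm]
          · simp [World.advance, Memory.path, hm, htr]) hl
        (by rw [used_advance_edge hp]; linarith) ⟨a, coincide_refl _, hk⟩
      have hph : (((c.advance N δ).next N (c.activated N δ)).agent a).mem.phase ≠ .parked := by
        rcases hhome with hhome | hhome
        · exact hhome.phase.1
        · exact hhome.phase
      have hlt : workload (((c.advance N δ).next N (c.activated N δ)).agent a) r <
          workload (c.agent a) (t a) := by
        simp only [workload, ht, hph, hs0.phase.1, if_false, List.length_cons]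
        omega
      refine ⟨r, .inr hhome, fun hpk => absurd hpk.phase hph, ?_, hlt.le, fun _ => hlt,
        fun heq => absurd heq hlt.ne⟩
      intro v hv
      rw [ht, List.mem_cons] at hv
      rcases hv with rfl | hv
      -- The node v has just been reached and leaves the list; the arrival activates everybody
      -- there, and the arriving agent counts as homebound.
      · refine .inr fun b e hb => ⟨mem_activated_of_arrival hp hx hb, a, ?_, hs0.homebound⟩
        rw [hb, hp1]
        exact coincide_node_iff.2 rfl
      · exact .inl hv
    · have hp1 := place_advance_edge hp hx
      obtain ⟨hm', hp'⟩ := next_edge (N := N) (S := c.activated N δ) hp1 fun hf => absurd hf hs0.phase.2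
      have hw : workload (((c.advance N δ).next N (c.activated N δ)).agent a) (t a) =
          workload (c.agent a) (t a) := workload_congr hm'
      have hpos := hδ.1.1
      have hle := nextEvent_le_len h.regular hδ hp
      refine ⟨t a, .inr (.inl ⟨u, w, x + δ, r, tr, hp', hadj, by linarith,
        lt_of_le_of_ne hle hx, ht, hl, ?_, mem_known_next hk, ?_⟩), fun hpk => ?_,
        fun v hv => .inl hv, hw.le, ?_, fun _ => ?_⟩
      · rw [used_next, used_advance_edge hp]
        linarith
      · rw [hm']
        exact hm
      · have := hpk.phase
        rw [hm'] at this
        exact absurd this hs0.phase.1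
      · rintro ⟨u', w', x', hp2, hx'⟩
        rw [hp] at hp2
        simp only [Place.edge.injEq] at hp2
        obtain ⟨rfl, rfl, rfl, -⟩ := hp2
        exact absurd hx' hx
      · rw [hp', hp, drift_edge]
  · have hs0 := hs
    obtain ⟨v, e, hp, hm, ht, hu, hk⟩ := hs
    have hp1 := place_advance_node (N := N) (δ := δ) hp
    obtain ⟨hm', hp'⟩ := next_of_back_home (N := N) (S := c.activated N δ) hp1 hm
    have hw : workload (((c.advance N δ).next N (c.activated N δ)).agent a) (t a) =
        workload (c.agent a) (t a) := workload_congr (hm'.trans hm.symm)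
    refine ⟨t a, .inr (.inr ⟨v, e, hp', hm', ht, ?_, mem_known_next hk⟩), fun hpk => ?_,
      fun v hv => .inl hv, hw.le, ?_, fun _ => ?_⟩
    · rwa [used_next, used_advance_node hp]
    · have := hpk.phase
      rw [hm'] at this
      simp at this
    · rintro ⟨u, w, x, hp2, -⟩
      rw [hp] at hp2
      simp at hp2
    · rw [hp', hp, Place.drift]

/-- The pairs of agents that move towards each other in the same edge. -/
def World.opposed (N : Network V) (c : World A Memory) : Set (A × A) :=
  {ab | ∃ u w x y, (c.agent ab.1).place = .edge u w x 1 ∧ (c.agent ab.2).place = .edge w u y 1 ∧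
    x + y < N.len u w}

/-- The measure is lexicographic. Arrivals lower the total workload. Meetings inside edges change no
decision but are events all the same; they are paid for by the number of pairs still moving towards
each other. -/
lemma Returning.step (h : Returning N B s c t rank) (hδ : c.NextEvent N δ) :
    ∃ t', Returning N B s ((c.advance N δ).next N (c.activated N δ)) t' rank ∧
      (∑ a, workload (((c.advance N δ).next N (c.activated N δ)).agent a) (t' a) <
        ∑ a, workload (c.agent a) (t a) ∨
      (∑ a, workload (((c.advance N δ).next N (c.activated N δ)).agent a) (t' a) =
        ∑ a, workload (c.agent a) (t a) ∧
        (((c.advance N δ).next N (c.activated N δ)).opposed N).ncard < (c.opposed N).ncard)) := by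
  choose t' hstate hparked htodo hle hlt heq using h.agent_step hδ
  refine ⟨t', ⟨fun a => timer_next (timer_advance (h.timer a)), hstate, ?_⟩, ?_⟩
  · intro a v e hp hph
    have hpk : IsParked N B (((c.advance N δ).next N (c.activated N δ)).agent a) (t' a) := by
      rcases hstate a with hs | hs | hs
      · exact hs
      · exact absurd hph hs.phase.1
      · exact absurd hph hs.phase
    obtain ⟨hph0, hpl, hn⟩ := hparked a hpk
    rw [hp] at hpl
    obtain ⟨b, hb, hv⟩ := h.wait a v e hpl.symm hph0
    refine ⟨b, hb, (htodo b v hv).resolve_right fun hall => hn ?_⟩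
    exact hall a e (place_advance_node hpl.symm)
  · by_cases hall : ∃ a, workload (((c.advance N δ).next N (c.activated N δ)).agent a) (t' a) <
        workload (c.agent a) (t a)
    · obtain ⟨a, ha⟩ := hall
      exact .inl (Finset.sum_lt_sum (fun a _ => hle a) ⟨a, Finset.mem_univ _, ha⟩)
    · push Not at hall
      have hw : ∀ a, _ := fun a => le_antisymm (hle a) (hall a)
      have hplace := fun a => heq a (hw a)
      refine .inr ⟨Finset.sum_congr rfl fun a _ => hw a, ?_⟩
      obtain ⟨a, b, u, w, x, y, ha, hb, hxy⟩ := (nextEvent_cases h.regular hδ).resolve_left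
        fun ⟨b, u, w, x, hb, hx⟩ => (hlt b ⟨u, w, x, hb, hx⟩).not_ge (hall b)
      have hpos := hδ.1.1
      -- When everybody drifts, offsets only grow, so no pair becomes opposed, and the pair that
      -- meets stops being so.
      refine Set.ncard_lt_ncard ⟨?_, fun hsub => ?_⟩ (Set.toFinite _)
      · rintro ⟨a', b'⟩ ⟨u', w', x', y', ha', hb', hxy'⟩
        simp only [hplace] at ha' hb'
        have hra := (h.regular a').2
        have hrb := (h.regular b').2
        cases hpa : (c.agent a').place with
        | node v e => rw [hpa] at ha'; simp [Place.drift] at ha'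
        | edge u₁ w₁ x₁ k₁ =>
          cases hpb : (c.agent b').place with
          | node v e => rw [hpb] at hb'; simp [Place.drift] at hb'
          | edge u₂ w₂ x₂ k₂ =>
            rw [hpa] at ha' hra
            rw [hpb] at hb' hrb
            obtain ⟨-, rfl, -⟩ := hra
            obtain ⟨-, rfl, -⟩ := hrb
            rw [drift_edge] at ha' hb'
            simp only [Place.edge.injEq] at ha' hb'
            obtain ⟨rfl, rfl, rfl, -⟩ := ha'
            obtain ⟨rfl, rfl, rfl, -⟩ := hb'
            exact ⟨_, _, _, _, hpa, hpb, by linarith⟩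
      · obtain ⟨u', w', x', y', ha', hb', hxy'⟩ :=
          hsub (show (a, b) ∈ c.opposed N from ⟨u, w, x, y, ha, hb, by linarith⟩)
        simp only [hplace, ha, hb, drift_edge, Place.edge.injEq] at ha' hb'
        obtain ⟨rfl, rfl, rfl, -⟩ := ha'
        obtain ⟨-, -, rfl, -⟩ := hb'
        linarith

lemma step_of_nextEvent (hδ : c.NextEvent N δ) :
    gather.Step N c ((c.advance N δ).next N (c.activated N δ)) := ⟨δ, hδ, rfl⟩

/-- If nobody moves, then everybody is at home. -/
lemma Returning.isHome (h : Returning N B s c t rank)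
    (hs : ∀ a u w x, (c.agent a).place ≠ .edge u w x 1) (a : A) :
    IsHome B s (c.agent a) (t a) := by
  have hno : ∀ a, ¬ IsHoming N B s (c.agent a) (t a) := fun a ⟨u, w, x, r, tr, hp, _⟩ =>
    hs a u w x hp
  refine ((h.state a).resolve_left fun hpk => ?_).resolve_left (hno a)
  classical
  -- A parked agent of maximal rank waits for an agent of higher rank with a nonempty remaining way,
  -- which is neither parked, nor moving, nor at home.
  obtain ⟨b, hb, hmax⟩ := Finset.exists_max_image
    (Finset.univ.filter fun b => IsParked N B (c.agent b) (t b)) rank ⟨a, by simpa using hpk⟩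
  have hb' : IsParked N B (c.agent b) (t b) := by simpa using hb
  have hb0 := hb'
  obtain ⟨v, e, tr, hm, hp, -⟩ := hb'
  obtain ⟨d, hd, hv⟩ := h.wait b v e hp hb0.phase
  rcases h.state d with hd' | hd' | hd'
  · exact absurd (hmax d (by simpa using hd')) (not_le.2 hd)
  · exact hno d hd'
  · obtain ⟨-, -, -, -, ht, -⟩ := hd'
    rw [ht] at hv
    simp at hv

theorem Returning.terminates (h : Returning N B s c t rank) :
    ∃ c' : World A Memory, Relation.ReflTransGen (gather.Step N) c c' ∧ c'.Quiescent ∧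
      ∀ a, s ∈ (c'.agent a).known ∧ (c'.agent a).used ≤ B := by
  generalize hn : ((∑ a, workload (c.agent a) (t a), (c.opposed N).ncard) : ℕ × ℕ) = n
  induction n using (WellFounded.prod_lex Nat.lt_wfRel.wf Nat.lt_wfRel.wf).induction
    generalizing c t with
  | _ n ih =>
    by_cases hs : ∀ a u w x, (c.agent a).place ≠ .edge u w x 1
    · refine ⟨c, .refl, fun a => ?_, fun a => ?_⟩
      · obtain ⟨v, e, hp, -⟩ := h.isHome hs a
        rw [hp]
        exact ⟨rfl, h.timer a⟩
      · obtain ⟨v, e, -, -, -, hu, hk⟩ := h.isHome hs a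
        exact ⟨hk, hu⟩
    · push Not at hs
      obtain ⟨a, u, w, x, hp⟩ := hs
      obtain ⟨δ, hδ⟩ := exists_nextEvent h.regular hp
      obtain ⟨t', h', hlt⟩ := h.step hδ
      obtain ⟨c', hc', hrest⟩ := ih _ (by
        rw [← hn]
        rcases hlt with hlt | ⟨heq, hlt⟩
        · exact Prod.Lex.left _ _ hlt
        · rw [heq]
          exact Prod.Lex.right _ hlt) h' rfl
      exact ⟨c', .head (step_of_nextEvent hδ) hc', hrest⟩

end Return

/-! ### Collecting information -/

section Collect

variable {V : Type*} {N : Network V} {A : Finset V} {c : World A Memory} {S : Set A} {a b : A}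
  {u v w s : V} {e : Option ℕ} {x y δ : ℝ} {l r : List V} {g : AgentState V Memory}
  {fire : V → Option (V × A)} {L : A → List V} {rank : A → ℕ} {K : ℕ}

/-- The agent that carries the information of `u` to `v` has arrived there. -/
def Moved (c : World A Memory) (fire : V → Option (V × A)) (u v : V) : Prop :=
  ∃ b, fire u = some (v, b) ∧ ∀ x, (c.agent b).place ≠ .edge u v x 1

/-- The agent waits at the first node of the way `l` on which it came. -/
def IsWaiting (N : Network V) (A : Finset V) (fire : V → Option (V × A))
    (g : AgentState V Memory) (l : List V) : Prop :=
  ∃ v r ph, g.place = .node v (r.head?.map (N.port v)) ∧ l = v :: r ∧ g.mem = ⟨ph, N.exits r⟩ ∧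
    g.used = N.wayLen (v :: r) ∧ g.used ≤ N.sep A ∧
    ((ph = .front ∧ fire v = none) ∨ (ph = .parked ∧ fire v ≠ none)) ∧
    ∀ u ∈ r.head?, ∀ x ∈ A, x ∈ side N.graph u v → ∀ p : N.graph.Walk x v, g.used ≤ N.walkLen p

/-- Agent `a` carries the information of the first node of the way `l` to the next node. -/
def IsMoving (N : Network V) (fire : V → Option (V × A)) (a : A) (g : AgentState V Memory)
    (l : List V) : Prop :=
  ∃ u w x r, g.place = .edge u w x 1 ∧ l = u :: r ∧ g.mem = ⟨.front, N.exits (u :: r)⟩ ∧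
    fire u = some (w, a) ∧ 0 ≤ x ∧ x < N.len u w ∧ g.used = N.wayLen (u :: r) + x ∧
    N.wayLen (u :: r) + N.len u w ≤ N.sep A ∧
    ∀ x ∈ A, x ∈ side N.graph u w → ∀ p : N.graph.Walk x u, N.wayLen (u :: r) ≤ N.walkLen p

/-- No agent has turned back so far.  The list `L a` contains the nodes that agent `a` has visited,
`fire v = some (w, b)` means that agent `b` left `v` towards `w` with the information of `v`, and
the ranks of parked agents are the times when they were parked. -/
structure Collecting (N : Network V) (s : V) (c : World A Memory) (L : A → List V)
    (fire : V → Option (V × A)) (rank : A → ℕ) (K : ℕ) : Prop where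
  timer : ∀ a, (c.agent a).timer = none
  chain : ∀ a, (L a).IsChain fun y x => fire x = some (y, a)
  last : ∀ a, (L a).getLast? = some a.1
  nodup : ∀ a, (L a).Nodup
  state : ∀ a, IsWaiting N A fire (c.agent a) (L a) ∨ IsMoving N fire a (c.agent a) (L a)
  adj : ∀ {v w b}, fire v = some (w, b) → N.graph.Adj v w
  moved : ∀ {v w b}, fire v = some (w, b) → ∀ u, N.graph.Adj u v → u ≠ w → Moved c fire u v
  trace : ∀ {v w b}, fire v = some (w, b) →
    (∃ x, (c.agent b).place = .edge v w x 1) ∨ (w ∈ L b ∧ v ∈ (L b).tail)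
  opposite : ∀ {u w a b}, fire u = some (w, a) → fire w = some (u, b) →
    ∃ x y, (c.agent a).place = .edge u w x 1 ∧ (c.agent b).place = .edge w u y 1 ∧
      x + y ≤ N.len u w
  rank_parked : ∀ a, (c.agent a).mem.phase = .parked → rank a < K
  rank_front : ∀ a, (c.agent a).mem.phase = .front → rank a = K
  rank_wait : ∀ {a v e w b}, (c.agent a).place = .node v e → fire v = some (w, b) →
    rank a < rank b
  known : ∃ a, (c.agent a).mem.phase = .front ∧ s ∈ (c.agent a).known

/-- Nobody is about to turn back or to leave a node. -/
structure Pending (N : Network V) (c : World A Memory) (fire : V → Option (V × A)) : Prop where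
  missing : ∀ {v}, fire v = none → ∃ u₁ u₂, u₁ ≠ u₂ ∧ N.graph.Adj u₁ v ∧ N.graph.Adj u₂ v ∧
    ¬ Moved c fire u₁ v ∧ ¬ Moved c fire u₂ v
  strict : ∀ {u w a b x y}, fire u = some (w, a) → fire w = some (u, b) →
    (c.agent a).place = .edge u w x 1 → (c.agent b).place = .edge w u y 1 → x + y < N.len u w

lemma exists_rel_of_mem_tail {α : Type*} {R : α → α → Prop} {l : List α} (h : l.IsChain R) {x : α}
    (hx : x ∈ l.tail) : ∃ y ∈ l, R y x := by
  induction l with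
  | nil => simp at hx
  | cons y l ih =>
    cases l with
    | nil => simp at hx
    | cons z l =>
      obtain ⟨hyz, hl⟩ := List.isChain_cons_cons.1 h
      rcases List.mem_cons.1 hx with rfl | hx
      · exact ⟨y, by simp, hyz⟩
      · obtain ⟨y', hy', h'⟩ := ih hl hx
        exact ⟨y', List.mem_cons_of_mem _ hy', h'⟩

/-! ### Reading off the whereabouts of agents from `fire` and `L` -/

namespace Collecting

lemma regular (h : Collecting N s c L fire rank K) : c.Regular N := by
  refine fun a => ⟨h.timer a, ?_⟩
  rcases h.state a with ⟨v, r, ph, hp, -⟩ | ⟨u, w, x, r, hp, -, -, hf, h0, h1, -⟩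
  · rw [hp]; trivial
  · rw [hp]; exact ⟨h.adj hf, rfl, h0, h1⟩

lemma moving_of_edge (h : Collecting N s c L fire rank K) {k : SignType}
    (hp : (c.agent a).place = .edge u w x k) : k = 1 ∧ fire u = some (w, a) ∧ 0 ≤ x ∧
      x < N.len u w ∧ (c.agent a).mem.phase = .front ∧ ∃ r, L a = u :: r := by
  rcases h.state a with ⟨v, r, ph, hp', -⟩ | ⟨u, w, x, r, hp', hl, hm, hf, h0, h1, -⟩
  · rw [hp'] at hp; simp at hp
  · rw [hp'] at hp
    simp only [Place.edge.injEq] at hp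
    obtain ⟨rfl, rfl, rfl, rfl⟩ := hp
    exact ⟨rfl, hf, h0, h1, by rw [hm], r, hl⟩

lemma waiting_of_node (h : Collecting N s c L fire rank K)
    (hp : (c.agent a).place = .node v e) :
    ∃ r ph, e = r.head?.map (N.port v) ∧ L a = v :: r ∧ (c.agent a).mem = ⟨ph, N.exits r⟩ ∧
    (c.agent a).used = N.wayLen (v :: r) ∧ (c.agent a).used ≤ N.sep A ∧
    ((ph = .front ∧ fire v = none) ∨ (ph = .parked ∧ fire v ≠ none)) ∧
    ∀ u ∈ r.head?, ∀ x ∈ A, x ∈ side N.graph u v →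
      ∀ p : N.graph.Walk x v, (c.agent a).used ≤ N.walkLen p := by
  rcases h.state a with ⟨v, r, ph, hp', hrest⟩ | ⟨u, w, x, r, hp', -⟩
  · rw [hp'] at hp
    simp only [Place.node.injEq] at hp
    obtain ⟨rfl, rfl⟩ := hp
    exact ⟨r, ph, rfl, hrest⟩
  · rw [hp'] at hp; simp at hp

/-- Lists are ordered from the newest node to the oldest, and each node but the newest was left by
the agent itself as its carrier. -/
lemma fired_of_mem_tail (h : Collecting N s c L fire rank K) (hx : v ∈ (L a).tail) :
    ∃ w ∈ L a, fire v = some (w, a) :=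
  exists_rel_of_mem_tail (h.chain a) hx

/-- An older node of the list would have fired. -/
lemma eq_cons_of_mem (h : Collecting N s c L fire rank K) (hv : v ∈ L a) (hf : fire v = none) :
    ∃ r, L a = v :: r := by
  cases hL : L a with
  | nil => rw [hL] at hv; simp at hv
  | cons x r =>
    rw [hL] at hv
    rcases List.mem_cons.1 hv with rfl | hv
    · exact ⟨r, rfl⟩
    · obtain ⟨w, -, hw⟩ := h.fired_of_mem_tail (a := a) (v := v) (by rw [hL]; exact hv)
      rw [hf] at hw
      simp at hw

lemma place_of_cons (h : Collecting N s c L fire rank K) (hL : L a = v :: r)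
    (hf : fire v = none) : (c.agent a).place = .node v (r.head?.map (N.port v)) := by
  rcases h.state a with ⟨v', r', ph, hp', hL', -⟩ | ⟨u, w, x, r', hp', hL', -, hf', -⟩
  · rw [hL, List.cons.injEq] at hL'
    obtain ⟨rfl, rfl⟩ := hL'
    exact hp'
  · rw [hL, List.cons.injEq] at hL'
    obtain ⟨rfl, rfl⟩ := hL'
    rw [hf] at hf'
    simp at hf'

/-- The agent that carries the information of `u` waits at `v`. -/
lemma exists_of_moved (h : Collecting N s c L fire rank K) (hm : Moved c fire u v)
    (hf : fire v = none) : ∃ b r, L b = v :: u :: r ∧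
      (c.agent b).place = .node v (some (N.port v u)) := by
  obtain ⟨b, hb, hne⟩ := hm
  obtain ⟨hv, hu⟩ := (h.trace hb).resolve_left fun ⟨x, hx⟩ => hne x hx
  obtain ⟨r, hL⟩ := h.eq_cons_of_mem hv hf
  have hr := h.place_of_cons hL hf
  have hch := h.chain b
  rw [hL] at hu hch
  cases r with
  | nil => simp at hu
  | cons z r =>
    by_cases hz : u = z
    · subst hz
      exact ⟨b, r, hL, hr⟩
    -- If u were not directly below v, its successor in the list, which is v again, would be an
    -- older node and hence would have fired.
    · have hur : u ∈ (z :: r).tail := (List.mem_cons.1 hu).resolve_left hz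
      obtain ⟨y, hy, hfy⟩ := exists_rel_of_mem_tail (List.isChain_cons_cons.1 hch).2 hur
      rw [hb] at hfy
      simp only [Option.some.injEq, Prod.mk.injEq] at hfy
      obtain ⟨rfl, -⟩ := hfy
      obtain ⟨w, -, hw⟩ := h.fired_of_mem_tail (a := b) (v := v) (by rw [hL]; exact hy)
      rw [hf] at hw
      simp at hw

lemma moved_of_cons (h : Collecting N s c L fire rank K) (hL : L a = v :: u :: r)
    (hp : (c.agent a).place = .node v e) : Moved c fire u v := by
  have hch := h.chain a
  rw [hL] at hch
  exact ⟨a, (List.isChain_cons_cons.1 hch).1, fun x hx => by rw [hp] at hx; simp at hx⟩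

/-- The agent that starts at a node is there until the information of the node is carried away. -/
lemma place_start (h : Collecting N s c L fire rank K) (hf : fire (a : V) = none) :
    L a = [(a : V)] ∧ (c.agent a).place = .node (a : V) none := by
  have hmem : (a : V) ∈ L a := List.mem_of_getLast? (h.last a)
  obtain ⟨r, hL⟩ := h.eq_cons_of_mem hmem hf
  have hr : r = [] := by
    by_contra hr
    have hlast := h.last a
    rw [hL, List.getLast?_cons_of_ne_nil hr] at hlast
    obtain ⟨w, -, hw⟩ := h.fired_of_mem_tail (a := a) (v := a)
      (by rw [hL]; exact List.mem_of_getLast? hlast)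
    rw [hf] at hw
    simp at hw
  subst hr
  exact ⟨hL, h.place_of_cons hL hf⟩

lemma not_homeboundAt (h : Collecting N s c L fire rank K) : ¬ c.HomeboundAt N a := by
  rintro ⟨b, -, hb⟩
  rcases h.state b with ⟨v, r, ph, -, -, hm, -, -, hph, -⟩ | ⟨u, w, x, r, -, -, hm, -⟩
  · rw [hm] at hb
    rcases hph with ⟨rfl, -⟩ | ⟨rfl, -⟩ <;> exact hb
  · rw [hm] at hb
    exact hb

lemma coincide_node (hset : ∀ a, (c.agent a).place.Settled N)
    (hp : (c.agent a).place = .node v e) :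
    Coincide N (c.agent a).place (c.agent b).place ↔ ∃ e', (c.agent b).place = .node v e' := by
  rw [hp]
  constructor
  · intro hc
    cases hb : (c.agent b).place with
    | node v' e' =>
      rw [hb] at hc
      rw [coincide_node_iff.1 hc]
      exact ⟨e', rfl⟩
    | edge u w x k =>
      have hs := hset b
      rw [hb] at hs hc
      exact absurd hc (not_coincide_node_edge hs.2.2.1 hs.2.2.2)
  · rintro ⟨e', he'⟩
    rw [he']
    exact coincide_node_iff.2 rfl

/-- The ports that an agent at `v` observes to be missing. -/
lemma missing_eq (h : Collecting N s c L fire rank K) (hset : ∀ a, (c.agent a).place.Settled N)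
    (hp : (c.agent a).place = .node v e) (hf : fire v = none) :
    c.missing N a v = N.port v '' {u | N.graph.Adj v u ∧ ¬ Moved c fire u v} := by
  ext p
  constructor
  · rintro ⟨hp1, hall⟩
    obtain ⟨u, hu, rfl⟩ := (N.port_bij v).surjOn hp1
    refine ⟨u, ⟨hu, fun hm => ?_⟩, rfl⟩
    obtain ⟨b, r, -, hb⟩ := h.exists_of_moved hm hf
    refine hall b ((coincide_node hset hp).2 ⟨_, hb⟩) ?_
    rw [hb]
    rfl
  · rintro ⟨u, ⟨hu, hm⟩, rfl⟩
    refine ⟨(N.port_bij v).mapsTo hu, fun b hb hentry => hm ?_⟩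
    obtain ⟨e', he'⟩ := (coincide_node hset hp).1 hb
    obtain ⟨r, ph, rfl, hL, -⟩ := h.waiting_of_node he'
    rw [he'] at hentry
    cases r with
    | nil => simp [Place.spot, Spot.entry] at hentry
    | cons z r =>
      simp only [Place.spot, Spot.entry, List.head?_cons, Option.map_some, Option.some.injEq]
        at hentry
      have hz := h.moved_of_cons hL he'
      obtain ⟨b', hb', -⟩ := id hz
      rwa [port_inj (h.adj hb').symm hu hentry] at hz

/-- Agents reach only nodes whose information has not been carried away. -/
lemma fire_eq_none_of_arrival (h : Collecting N s c L fire rank K) (hpd : Pending N c fire)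
    (hδ : c.NextEvent N δ) (hp : (c.agent a).place = .edge u w x 1) (hx : x + δ = N.len u w) :
    fire w = none := by
  obtain ⟨-, hfu, -⟩ := h.moving_of_edge hp
  cases hw : fire w with
  | none => rfl
  | some q =>
    obtain ⟨z, b⟩ := q
    -- If w has fired towards u, the two agents face each other and meet before either arrives. If w
    -- has fired elsewhere, it did so only after the carrier from u had arrived.
    by_cases hz : u = z
    · subst hz
      obtain ⟨x', y, ha, hb, -⟩ := h.opposite hfu hw
      rw [hp] at ha
      simp only [Place.edge.injEq, and_true, true_and] at ha
      subst ha
      have hlt := hpd.strict hfu hw hp hb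
      have hle := nextEvent_le_meet h.regular hδ hp hb hlt
      obtain ⟨-, -, hy, -⟩ := h.moving_of_edge hb
      linarith [hδ.1.1]
    · obtain ⟨b', hb', hne⟩ := h.moved hw u (h.adj hfu) hz
      rw [hfu] at hb'
      simp only [Option.some.injEq, Prod.mk.injEq, true_and] at hb'
      subst hb'
      exact absurd hp (hne x)

end Collecting

open Classical in
/-- The nodes visited `δ` units of time later. -/
noncomputable def visited (N : Network V) (δ : ℝ) (p : Place V) (l : List V) : List V :=
  match p with
  | .node _ _ => l
  | .edge u w x _ => if x + δ = N.len u w then w :: l else l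

lemma visited_arrival {k : SignType} (hx : x + δ = N.len u w) :
    visited N δ (.edge u w x k) l = w :: l := by simp [visited, hx]

lemma visited_edge {k : SignType} (hx : x + δ ≠ N.len u w) :
    visited N δ (.edge u w x k) l = l := by simp [visited, hx]

lemma visited_node : visited N δ (.node v e) l = l := rfl

lemma visited_eq (p : Place V) : visited N δ p l = l ∨ ∃ w, visited N δ p l = w :: l := by
  cases p with
  | node v e => exact .inl rfl
  | edge u w x k =>
    by_cases hx : x + δ = N.len u w
    · exact .inr ⟨w, visited_arrival hx⟩
    · exact .inl (visited_edge hx)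

lemma place_of_advance_edge (hc : c.Regular N)
    (h : ((c.advance N δ).agent a).place = .edge u w x 1) :
    ∃ y, (c.agent a).place = .edge u w y 1 ∧ y + δ = x ∧ x ≠ N.len u w := by
  cases hp : (c.agent a).place with
  | node v e => rw [place_advance_node hp] at h; simp at h
  | edge u' w' y k =>
    have hr := (hc a).2
    rw [hp] at hr
    obtain ⟨-, rfl, -⟩ := hr
    by_cases hy : y + δ = N.len u' w'
    · rw [place_advance_arrival hp hy] at h; simp at h
    · rw [place_advance_edge hp hy] at h
      simp only [Place.edge.injEq, and_true] at h
      obtain ⟨rfl, rfl, rfl⟩ := h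
      exact ⟨y, rfl, rfl, hy⟩

lemma Moved.advance (hc : c.Regular N) (h : Moved c fire u v) :
    Moved (c.advance N δ) fire u v := by
  obtain ⟨b, hb, hne⟩ := h
  refine ⟨b, hb, fun x hx => ?_⟩
  obtain ⟨y, hy, -⟩ := place_of_advance_edge hc hx
  exact hne y hy

/-- No decision falls between events, so only `L` changes. The strict inequality of `Pending` may
become an equality for agents that face each other, which is why the field `opposite` is weak. -/
lemma Collecting.advance (h : Collecting N s c L fire rank K) (hG : N.graph.IsAcyclic)
    (hpd : Pending N c fire) (hδ : c.NextEvent N δ) :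
    Collecting N s (c.advance N δ) (fun a => visited N δ (c.agent a).place (L a)) fire rank K := by
  have hpos := hδ.1.1
  have hreg := h.regular
  refine ⟨fun a => timer_advance (h.timer a), fun a => ?_, fun a => ?_, fun a => ?_, fun a => ?_,
    h.adj, fun hf u hu hne => (h.moved hf u hu hne).advance hreg, fun {v w b} hf => ?_,
    fun {u w a b} hfu hfw => ?_, h.rank_parked, h.rank_front, fun {a v e w b} hp hf => ?_, h.known⟩
  · have hch := h.chain a
    rcases h.state a with ⟨v, r, ph, hp, -⟩ | ⟨u, w, x, r, hp, hL, -, hf, -⟩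
    · rwa [hp, visited_node]
    · by_cases hx : x + δ = N.len u w
      · rw [hp, visited_arrival hx, hL]
        rw [hL] at hch
        exact List.isChain_cons_cons.2 ⟨hf, hch⟩
      · rwa [hp, visited_edge hx]
  · have hl := h.last a
    rcases visited_eq (N := N) (δ := δ) (l := L a) (c.agent a).place with hv | ⟨w, hv⟩
    · rwa [hv]
    · rw [hv, List.getLast?_cons_of_ne_nil, hl]
      rintro hn
      rw [hn] at hl
      simp at hl
  · have hn := h.nodup a
    rcases h.state a with ⟨v, r, ph, hp, -⟩ | ⟨u, w, x, r, hp, hL, -, hf, -⟩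
    · rwa [hp, visited_node]
    · by_cases hx : x + δ = N.len u w
      · rw [hp, visited_arrival hx]
        -- The node w has not fired, so if it had been visited before, the agent would still be
        -- there.
        refine List.nodup_cons.2 ⟨fun hw => ?_, hn⟩
        have hfw := h.fire_eq_none_of_arrival hpd hδ hp hx
        obtain ⟨r', hL'⟩ := h.eq_cons_of_mem hw hfw
        have := h.place_of_cons hL' hfw
        rw [hp] at this
        simp at this
      · rwa [hp, visited_edge hx]
  · rcases h.state a with ⟨v, r, ph, hp, hL, hm, hu, hD, hph, hnear⟩ |
      ⟨u, w, x, r, hp, hL, hm, hf, h0, h1, hu, hD, hnear⟩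
    · left
      refine ⟨v, r, ph, place_advance_node hp, by rw [hp, visited_node, hL], hm, ?_⟩
      rw [used_advance_node hp]
      exact ⟨hu, hD, hph, hnear⟩
    · by_cases hx : x + δ = N.len u w
      · left
        refine ⟨w, u :: r, .front, place_advance_arrival hp hx, by rw [hp, visited_arrival hx, hL],
          hm, ?_⟩
        have hlen : N.wayLen (w :: u :: r) = N.len u w + N.wayLen (u :: r) := by
          rw [Network.wayLen, N.len_symm]
        rw [used_advance_edge hp, hlen]
        refine ⟨by linarith, by linarith, .inl ⟨rfl, h.fire_eq_none_of_arrival hpd hδ hp hx⟩, ?_⟩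
        intro u' hu' x' hx'A hx' p
        simp only [List.head?_cons, Option.mem_def, Option.some.injEq] at hu'
        subst hu'
        -- A walk to w from behind the edge must traverse this edge, so the bound at u extends to w
        -- by its length.
        obtain ⟨q, hq⟩ := exists_walk_to_side p hx' (notMem_side hG (h.adj hf))
        linarith [hnear x' hx'A hx' q]
      · right
        refine ⟨u, w, x + δ, r, place_advance_edge hp hx, by rw [hp, visited_edge hx, hL], hm, hf,
          by linarith, lt_of_le_of_ne (nextEvent_le_len hreg hδ hp) hx, ?_, hD, hnear⟩
        rw [used_advance_edge hp]
        linarith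
  · rcases h.trace hf with ⟨x, hp⟩ | ⟨hw, hv⟩
    · by_cases hx : x + δ = N.len v w
      · obtain ⟨-, -, -, -, -, r, hL⟩ := h.moving_of_edge hp
        right
        rw [hp, visited_arrival hx, hL]
        simp
      · exact .inl ⟨_, place_advance_edge hp hx⟩
    · right
      rcases visited_eq (N := N) (δ := δ) (l := L b) (c.agent b).place with hv' | ⟨w', hv'⟩
      · rw [hv']
        exact ⟨hw, hv⟩
      · rw [hv']
        exact ⟨List.mem_cons_of_mem _ hw, List.mem_of_mem_tail hv⟩
  · obtain ⟨x, y, ha, hb, -⟩ := h.opposite hfu hfw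
    have hlt := hpd.strict hfu hfw ha hb
    have hle := nextEvent_le_meet hreg hδ ha hb hlt
    obtain ⟨-, -, hx0, -⟩ := h.moving_of_edge ha
    obtain ⟨-, -, hy0, -⟩ := h.moving_of_edge hb
    refine ⟨x + δ, y + δ, place_advance_edge ha fun hx => by linarith,
      place_advance_edge hb fun hy => ?_, by linarith⟩
    rw [N.len_symm] at hy
    linarith
  · rcases h.state a with ⟨v', r, ph, hp', -⟩ | ⟨u, w', x, r, hp', -⟩
    · rw [place_advance_node hp'] at hp
      exact h.rank_wait (hp'.trans hp) hf
    · by_cases hx : x + δ = N.len u w'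
      · rw [place_advance_arrival hp' hx] at hp
        simp only [Place.node.injEq] at hp
        obtain ⟨rfl, -⟩ := hp
        rw [h.fire_eq_none_of_arrival hpd hδ hp' hx] at hf
        simp at hf
      · rw [place_advance_edge hp' hx] at hp
        simp at hp

end Collect

section Collect

variable {V : Type*} {N : Network V} {A : Finset V} {c : World A Memory} {S : Set A} {a b : A}
  {u v w s : V} {e : Option ℕ} {x y δ : ℝ} {l r : List V} {g : AgentState V Memory}
  {fire : V → Option (V × A)} {L : A → List V} {rank : A → ℕ} {K : ℕ}

/-! ### Turning back -/

/-- The nodes that an agent is yet to visit when it turns back. -/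
def homeWay (p : Place V) (l : List V) : List V :=
  match p with
  | .node _ _ => l.tail
  | .edge _ w _ _ => w :: l

lemma mem_homeWay (p : Place V) (h : v ∈ l.tail) : v ∈ homeWay p l := by
  cases p with
  | node _ _ => exact h
  | edge _ _ _ _ => exact List.mem_cons_of_mem _ (List.mem_of_mem_tail h)

namespace Collecting

/-- If all agents that are not parked meet in one point, then they turn back. -/
lemma turn (h : Collecting N s c L fire rank K)
    (hS : ∀ a, (c.agent a).mem.phase = .front → a ∈ S)
    (hmeet : ∀ a b, (c.agent a).mem.phase = .front → (c.agent b).mem.phase = .front →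
      Coincide N (c.agent a).place (c.agent b).place)
    (hnode : ∀ a v e, (c.agent a).mem.phase = .front → (c.agent a).place = .node v e →
      c.missing N a v = ∅)
    (hedge : ∀ a u w x, (c.agent a).place = .edge u w x 1 →
      ∃ b, b ≠ a ∧ Coincide N (c.agent a).place (c.agent b).place) :
    Returning N (2 * N.sep A) s (c.next N S) (fun a => homeWay (c.agent a).place (L a)) rank := by
  have hchain : ∀ a, (L a).IsChain N.graph.Adj := fun a =>
    (h.chain a).imp fun y x hyx => (h.adj hyx).symm
  have hknown : ∀ a, (c.agent a).mem.phase = .front → s ∈ c.knownAt N a := by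
    obtain ⟨b, hb, hs⟩ := h.known
    exact fun a ha => ⟨b, hmeet a b ha hb, hs⟩
  have hstate : ∀ a, (IsParked N (2 * N.sep A) ((c.next N S).agent a)
        (homeWay (c.agent a).place (L a)) ∧ (c.agent a).mem.phase = .parked ∧
        ((c.next N S).agent a).place = (c.agent a).place) ∨
      IsHoming N (2 * N.sep A) s ((c.next N S).agent a) (homeWay (c.agent a).place (L a)) ∨
      IsHome (2 * N.sep A) s ((c.next N S).agent a) (homeWay (c.agent a).place (L a)) := by
    intro a
    have hch := hchain a
    rcases h.state a with ⟨v, r, ph, hp, hL, hm, hu, hD, hph, hnear⟩ |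
      ⟨u, w, x, r, hp, hL, hm, hf, h0, h1, hu, hD, hnear⟩
    · rw [hL] at hch
      rw [hp, homeWay, hL, List.tail_cons]
      rcases hph with ⟨rfl, hf⟩ | ⟨rfl, hf⟩
      · have hfr : (c.agent a).mem.phase = .front := by rw [hm]
        refine .inr (homing_or_home (hS a hfr) hp (.inr ⟨hfr, hnode a v _ hfr hp⟩) ?_ hch
          (by linarith) (hknown a hfr))
        rw [exits_cons, hm]
        rfl
      · obtain ⟨hm', hp'⟩ := next_parked (S := S) hp (by rw [hm]) h.not_homeboundAt
        refine .inl ⟨⟨v, _, _, hm'.trans hm, hp', hch, exits_cons.symm, ?_⟩, by rw [hm], hp'⟩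
        rw [used_next]
        linarith
    · rw [hL] at hch
      have hfr : (c.agent a).mem.phase = .front := by rw [hm]
      obtain ⟨b, hne, hb⟩ := hedge a u w x hp
      obtain ⟨hm', hp'⟩ := next_edge_meet (hS a hfr) hp hfr hne hb
      refine .inr (.inl ⟨u, w, x, u :: r, _, hp', h.adj hf, h0, h1, by rw [hp, homeWay, hL],
        List.isChain_cons_cons.2 ⟨(h.adj hf).symm, hch⟩, ?_, ?_, .inr ⟨hm', ?_⟩⟩)
      -- The rest of this edge, the edge back, and the whole way home: twice the way to u plus twice
      -- the edge, hence at most 2D.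
      · rw [used_next, Network.wayLen, N.len_symm w]
        linarith
      · rw [known_next]
        exact hknown a hfr
      · rw [hm]
        rfl
  refine ⟨fun a => timer_next (h.timer a), fun a => (hstate a).imp_left And.left, ?_⟩
  intro a v e hp hph
  obtain ⟨-, hpk, hpl⟩ := (hstate a).resolve_right (by
    rintro (hs | hs)
    · exact hs.phase.1 hph
    · exact hs.phase hph)
  rw [hpl] at hp
  obtain ⟨r, ph, -, -, hm, -, -, hfire, -⟩ := h.waiting_of_node hp
  have hf : fire v ≠ none := by
    rw [hm] at hpk
    rcases hfire with ⟨rfl, -⟩ | ⟨-, hf⟩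
    · simp at hpk
    · exact hf
  -- The parked agent waits for the carrier b that left its node: the node is behind b in its list
  -- and so on its way home.
  obtain ⟨⟨w, b⟩, hwb⟩ := Option.ne_none_iff_exists'.1 hf
  refine ⟨b, h.rank_wait hp hwb, ?_⟩
  rcases h.trace hwb with ⟨x, hx⟩ | ⟨-, hv⟩
  · obtain ⟨-, -, -, -, -, r', hL⟩ := h.moving_of_edge hx
    rw [hx, homeWay, hL]
    simp
  · exact mem_homeWay _ hv

/-- Everything behind the edge `vw` has been collected when an agent leaves `v` towards `w`. -/
lemma moved_of_mem_side [Finite V] (h : Collecting N s c L fire rank K)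
    (hG : N.graph.IsAcyclic) : ∀ v w, N.graph.Adj v w → (∃ b, fire v = some (w, b)) →
      ∀ x ∈ side N.graph v w, x ≠ v → ∃ y, Moved c fire x y := by
  refine dart_induction hG fun v w _ ih ⟨b, hb⟩ x hx hne => ?_
  obtain ⟨u, hu, huw, hxu⟩ := exists_side_of_mem_side hx hne
  have hm := h.moved hb u hu huw
  by_cases hxu' : x = u
  · subst hxu'
    exact ⟨v, hm⟩
  · obtain ⟨b', hb', -⟩ := id hm
    exact ih u hu huw ⟨b', hb'⟩ x hxu hxu'

/-- The nodes of the agents that are not parked. -/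
lemma not_moved_of_front (h : Collecting N s c L fire rank K)
    (ha : (c.agent a).mem.phase = .front) :
    (∃ v e, (c.agent a).place = .node v e ∧ fire v = none) ∨
    ∃ u w x, (c.agent a).place = .edge u w x 1 ∧ fire u = some (w, a) ∧
      ∀ y, ¬ Moved c fire u y := by
  rcases h.state a with ⟨v, r, ph, hp, hL, hm, hu, hD, hph, hnear⟩ |
    ⟨u, w, x, r, hp, hL, hm, hf, -⟩
  · rcases hph with ⟨rfl, hf⟩ | ⟨rfl, -⟩
    · exact .inl ⟨v, _, hp, hf⟩
    · rw [hm] at ha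
      simp at ha
  · refine .inr ⟨u, w, x, hp, hf, ?_⟩
    rintro y ⟨b, hb, hne⟩
    rw [hf] at hb
    simp only [Option.some.injEq, Prod.mk.injEq] at hb
    obtain ⟨rfl, rfl⟩ := hb
    exact hne x hp

/-- Both endpoints have fired towards each other, so everything behind either of them has been
collected, and the two sides cover the tree. Hence a and b are the only agents not parked. -/
lemma turn_at_edge [Finite V] (h : Collecting N s c L fire rank K) (hG : N.graph.IsTree)
    (ha : (c.agent a).place = .edge u w x 1) (hb : (c.agent b).place = .edge w u y 1)
    (hxy : x + y = N.len u w) (haS : a ∈ S) (hbS : b ∈ S) :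
    ∃ t rank', Returning N (2 * N.sep A) s (c.next N S) t rank' := by
  obtain ⟨-, hfa, -⟩ := h.moving_of_edge ha
  obtain ⟨-, hfb, -⟩ := h.moving_of_edge hb
  have hadj := h.adj hfa
  have hmoved : ∀ z, z ≠ u → z ≠ w → ∃ y, Moved c fire z y := by
    intro z hzu hzw
    rcases side_total hG u w z with hz | hz
    · exact h.moved_of_mem_side hG.isAcyclic u w hadj ⟨a, hfa⟩ z hz hzu
    · exact h.moved_of_mem_side hG.isAcyclic w u hadj.symm ⟨b, hfb⟩ z hz hzw
  have hfront : ∀ d, (c.agent d).mem.phase = .front → d = a ∨ d = b := by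
    intro d hd
    rcases h.not_moved_of_front hd with ⟨v, e, -, hf⟩ | ⟨u', w', x', -, hf, hn⟩
    · exfalso
      by_cases hvu : v = u
      · rw [hvu, hfa] at hf
        simp at hf
      · by_cases hvw : v = w
        · rw [hvw, hfb] at hf
          simp at hf
        · obtain ⟨y, b', hb', -⟩ := hmoved v hvu hvw
          rw [hf] at hb'
          simp at hb'
    · by_cases hu : u' = u
      · rw [hu, hfa] at hf
        simp only [Option.some.injEq, Prod.mk.injEq] at hf
        exact .inl hf.2.symm
      · by_cases hw : u' = w
        · rw [hw, hfb] at hf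
          simp only [Option.some.injEq, Prod.mk.injEq] at hf
          exact .inr hf.2.symm
        · obtain ⟨y, hy⟩ := hmoved u' hu hw
          exact absurd hy (hn y)
  have hab : Coincide N (c.agent a).place (c.agent b).place := by
    rw [ha, hb]
    exact coincide_edge_opposite hxy
  have hne : a ≠ b := by
    rintro rfl
    rw [ha] at hb
    simp only [Place.edge.injEq] at hb
    exact hadj.ne hb.1
  refine ⟨_, _, h.turn ?_ ?_ ?_ ?_⟩
  · intro d hd
    rcases hfront d hd with rfl | rfl
    · exact haS
    · exact hbS
  · intro d d' hd hd'
    rcases hfront d hd with rfl | rfl <;> rcases hfront d' hd' with rfl | rfl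
    · exact coincide_refl _
    · exact hab
    · exact hab.symm
    · exact coincide_refl _
  · intro d v e hd hp
    exfalso
    rcases hfront d hd with rfl | rfl
    · rw [hp] at ha
      simp at ha
    · rw [hp] at hb
      simp at hb
  · intro d u' w' x' hp
    obtain ⟨-, -, -, -, hd, -⟩ := h.moving_of_edge hp
    rcases hfront d hd with rfl | rfl
    · exact ⟨b, hne.symm, hab⟩
    · exact ⟨a, hne, hab.symm⟩

/-- Every node other than v lies behind some edge uv whose carrier has arrived, so all agents that
are not parked are at v. -/
lemma turn_at_node [Finite V] (h : Collecting N s c L fire rank K) (hG : N.graph.IsTree)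
    (hset : ∀ a, (c.agent a).place.Settled N) (hf : fire v = none)
    (hall : ∀ u, N.graph.Adj u v → Moved c fire u v)
    (hS : ∀ a e, (c.agent a).place = .node v e → a ∈ S) :
    ∃ t rank', Returning N (2 * N.sep A) s (c.next N S) t rank' := by
  have hmoved : ∀ z, z ≠ v → ∃ y, Moved c fire z y := by
    intro z hz
    obtain ⟨u, hu, hzu⟩ : ∃ u, N.graph.Adj u v ∧ z ∈ side N.graph u v := by
      obtain ⟨p⟩ := hG.connected.preconnected v z
      cases p with
      | nil => exact absurd rfl hz
      | @cons _ w _ hvw p =>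
        rcases side_total hG v w z with hz' | hz'
        · obtain ⟨u, hu, -, hzu⟩ := exists_side_of_mem_side hz' hz
          exact ⟨u, hu, hzu⟩
        · exact ⟨w, hvw.symm, hz'⟩
    by_cases hzu' : z = u
    · subst hzu'
      exact ⟨v, hall z hu⟩
    · obtain ⟨b, hb, -⟩ := hall u hu
      exact h.moved_of_mem_side hG.isAcyclic u v hu ⟨b, hb⟩ z hzu hzu'
  have hfront : ∀ d, (c.agent d).mem.phase = .front → ∃ e, (c.agent d).place = .node v e := by
    intro d hd
    rcases h.not_moved_of_front hd with ⟨v', e, hp, hf'⟩ | ⟨u', w', x', -, hf', hn⟩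
    · by_cases hv : v' = v
      · exact ⟨e, hv ▸ hp⟩
      · obtain ⟨y, b', hb', -⟩ := hmoved v' hv
        rw [hf'] at hb'
        simp at hb'
    · by_cases hv : u' = v
      · rw [hv, hf] at hf'
        simp at hf'
      · obtain ⟨y, hy⟩ := hmoved u' hv
        exact absurd hy (hn y)
  refine ⟨_, _, h.turn ?_ ?_ ?_ ?_⟩
  · intro d hd
    obtain ⟨e, he⟩ := hfront d hd
    exact hS d e he
  · intro d d' hd hd'
    obtain ⟨e, he⟩ := hfront d hd
    exact (coincide_node hset he).2 (hfront d' hd')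
  · intro d v' e hd hp
    obtain ⟨e', he'⟩ := hfront d hd
    have hv : v' = v := by
      rw [hp] at he'
      simp only [Place.node.injEq] at he'
      exact he'.1
    subst hv
    rw [h.missing_eq hset hp hf, Set.image_eq_empty, Set.eq_empty_iff_forall_notMem]
    exact fun u hu => hu.2 (hall u hu.1.symm)
  · intro d u' w' x' hp
    obtain ⟨-, -, -, -, hd, -⟩ := h.moving_of_edge hp
    obtain ⟨e, he⟩ := hfront d hd
    rw [hp] at he
    simp at he

end Collecting

/-- The information has come to `v` from all sides except `w`. -/
def Ready (N : Network V) (c : World A Memory) (fire : V → Option (V × A)) (v w : V) : Prop :=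
  fire v = none ∧ N.graph.Adj v w ∧ ¬ Moved c fire w v ∧
    ∀ u, N.graph.Adj u v → u ≠ w → Moved c fire u v

/-! ### The agent that leaves a node, and absence of deadlock -/

namespace Collecting

/-- Agents at the same node have different keys. -/
lemma key_injective (h : Collecting N s c L fire rank K) {e e' : Option ℕ}
    (ha : (c.agent a).place = .node v e) (hb : (c.agent b).place = .node v e')
    (hk : (c.reading N a).key = (c.reading N b).key) : a = b := by
  obtain ⟨r, ph, rfl, hL, -⟩ := h.waiting_of_node ha
  obtain ⟨r', ph', rfl, hL', -⟩ := h.waiting_of_node hb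
  -- The second component of the key decides: ports are at least 1, the default 0 marks the agent
  -- that starts here, and at most one carrier comes through each port.
  have hk2 : (r.head?.map (N.port v)).getD 0 = (r'.head?.map (N.port v)).getD 0 := by
    have := congrArg (fun k => (ofLex k).2) hk
    simpa [Reading.key, reading_spot ha, reading_spot hb, Spot.entry] using this
  have hpos : ∀ {d : A} {z : V} {q : List V} {e : Option ℕ}, L d = v :: z :: q →
      (c.agent d).place = .node v e → fire z = some (v, d) ∧ N.graph.Adj v z ∧
        1 ≤ N.port v z := by
    intro d z q e hL hp
    have hch := h.chain d
    rw [hL] at hch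
    have hz := (List.isChain_cons_cons.1 hch).1
    exact ⟨hz, (h.adj hz).symm, ((N.port_bij v).mapsTo (h.adj hz).symm).1⟩
  have hlast : ∀ {d : A}, L d = [v] → (d : V) = v := by
    intro d hd
    have := h.last d
    rw [hd] at this
    simpa using this.symm
  cases r with
  | nil =>
    cases r' with
    | nil => exact Subtype.ext ((hlast hL).trans (hlast hL').symm)
    | cons z q =>
      obtain ⟨-, -, hp⟩ := hpos hL' hb
      simp only [List.head?_nil, List.head?_cons, Option.map_none, Option.map_some,
        Option.getD_none, Option.getD_some] at hk2
      omega
  | cons z q =>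
    obtain ⟨hz, hadj, hp⟩ := hpos hL ha
    cases r' with
    | nil =>
      simp only [List.head?_nil, List.head?_cons, Option.map_none, Option.map_some,
        Option.getD_none, Option.getD_some] at hk2
      omega
    | cons z' q' =>
      obtain ⟨hz', hadj', -⟩ := hpos hL' hb
      simp only [List.head?_cons, Option.map_some, Option.getD_some] at hk2
      obtain rfl := port_inj hadj hadj' hk2
      rw [hz] at hz'
      simpa using hz'

/-- The agent that leaves `v`. -/
lemma exists_least (h : Collecting N s c L fire rank K) (hA : ∀ v, N.deg v = 1 → v ∈ A)
    (hr : Ready N c fire v w) : ∃ b e, (c.agent b).place = .node v e ∧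
      ∀ a e, (c.agent a).place = .node v e → (c.reading N b).key ≤ (c.reading N a).key := by
  have hne : ∃ b e, (c.agent b).place = .node v e := by
    by_cases hu : ∃ u, N.graph.Adj u v ∧ u ≠ w
    · obtain ⟨u, hu, huw⟩ := hu
      obtain ⟨b, r, -, hb⟩ := h.exists_of_moved (hr.2.2.2 u hu huw) hr.1
      exact ⟨b, _, hb⟩
    -- With w as its only neighbour, v is a leaf, so an agent starts there.
    · push Not at hu
      have hv : v ∈ A := by
        refine hA v ?_
        unfold Network.deg
        rw [Set.ncard_eq_one]
        exact ⟨w, Set.eq_singleton_iff_unique_mem.2 ⟨hr.2.1, fun u hvu => hu u hvu.symm⟩⟩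
      exact ⟨⟨v, hv⟩, none, (h.place_start (a := ⟨v, hv⟩) hr.1).2⟩
  classical
  obtain ⟨b, e, hb⟩ := hne
  obtain ⟨b', hb', hmin⟩ := Finset.exists_min_image
    (Finset.univ.filter fun b => ∃ e, (c.agent b).place = .node v e) (fun b => (c.reading N b).key)
    ⟨b, by simpa using ⟨e, hb⟩⟩
  obtain ⟨e', he'⟩ := (Finset.mem_filter.1 hb').2
  exact ⟨b', e', he', fun a e ha => hmin a (by simpa using ⟨e, ha⟩)⟩

/-- If nobody moves, induction away from the leaves shows that every dart has been traversed: an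
unfired node lacks two neighbours, and a node that fired elsewhere would face its target. But then
both ends of an edge have fired at each other, which requires moving agents. -/
lemma exists_moving [Finite V] (h : Collecting N s c L fire rank K) (hG : N.graph.IsAcyclic)
    (hpd : Pending N c fire) : ∃ a u w x, (c.agent a).place = .edge u w x 1 := by
  by_contra! hno
  have hopp : ∀ {u w a b}, fire u = some (w, a) → fire w = some (u, b) → False := by
    intro u w a b hu hw
    obtain ⟨x, y, ha, -⟩ := h.opposite hu hw
    exact hno _ _ _ _ ha
  have hall : ∀ v w, N.graph.Adj v w → Moved c fire v w := by
    refine dart_induction hG fun v w hvw ih => ?_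
    cases hf : fire v with
    | none =>
      obtain ⟨u₁, u₂, hne, h₁, h₂, hm₁, hm₂⟩ := hpd.missing hf
      by_cases hu : u₁ = w
      · exact absurd (ih u₂ h₂ fun h => hne (hu.trans h.symm)) hm₂
      · exact absurd (ih u₁ h₁ hu) hm₁
    | some q =>
      obtain ⟨z, b⟩ := q
      by_cases hz : z = w
      · subst hz
        exact ⟨b, hf, fun x => hno _ _ _ _⟩
      · obtain ⟨b', hb', -⟩ := ih z (h.adj hf).symm hz
        exact (hopp hf hb').elim
  have hedge : ∃ u w, N.graph.Adj u w := by
    cases hf : fire s with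
    | none =>
      obtain ⟨u₁, -, -, h₁, -⟩ := hpd.missing hf
      exact ⟨u₁, s, h₁⟩
    | some q => exact ⟨s, q.1, h.adj hf⟩
  obtain ⟨u, w, huw⟩ := hedge
  obtain ⟨a, ha, -⟩ := hall u w huw
  obtain ⟨b, hb, -⟩ := hall w u huw.symm
  exact hopp ha hb

end Collecting

end Collect

section Proceed

variable {V : Type*} {N : Network V} {A : Finset V} {c : World A Memory} {S : Set A} {a b : A}
  {u v w s : V} {e : Option ℕ} {x y δ : ℝ} {l r : List V} {g : AgentState V Memory}
  {fire fire' : V → Option (V × A)} {L : A → List V} {rank : A → ℕ} {K : ℕ}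

/-! ### Carrying information on -/

/-- Agent `b` is the one that leaves `v`. -/
def Least (N : Network V) (c : World A Memory) (v : V) (b : A) : Prop :=
  (∃ e, (c.agent b).place = .node v e) ∧
    ∀ a e, (c.agent a).place = .node v e → (c.reading N b).key ≤ (c.reading N a).key

/-- The departures after the next activation of the agents. -/
structure Departures (N : Network V) (c : World A Memory) (fire fire' : V → Option (V × A)) :
    Prop where
  mono : ∀ {v q}, fire v = some q → fire' v = some q
  ready : ∀ {v w}, Ready N c fire v w → ∃ b, fire' v = some (w, b) ∧ Least N c v b
  cases : ∀ {v w b}, fire' v = some (w, b) →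
    fire v = some (w, b) ∨ (Ready N c fire v w ∧ Least N c v b)

lemma Departures.eq_none (h : Departures N c fire fire') (hf : fire' v = none) :
    fire v = none ∧ ∀ w, ¬ Ready N c fire v w := by
  refine ⟨?_, fun w hw => ?_⟩
  · cases hv : fire v with
    | none => rfl
    | some q => rw [h.mono hv] at hf; simp at hf
  · obtain ⟨b, hb, -⟩ := h.ready hw
    rw [hb] at hf
    simp at hf

lemma Ready.unique (h : Ready N c fire v w) (h' : Ready N c fire v u) : u = w := by
  by_contra hne
  exact h'.2.2.1 (h.2.2.2 u h'.2.1.symm hne)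

lemma Collecting.missing_of_ready (h : Collecting N s c L fire rank K)
    (hset : ∀ a, (c.agent a).place.Settled N) (hp : (c.agent a).place = .node v e)
    (hr : Ready N c fire v w) : c.missing N a v = {N.port v w} := by
  rw [h.missing_eq hset hp hr.1, ← Set.image_singleton]
  congr 1
  ext u
  simp only [Set.mem_ofPred_eq, Set.mem_singleton_iff]
  constructor
  · rintro ⟨hu, hm⟩
    by_contra hne
    exact hm (hr.2.2.2 u hu.symm hne)
  · rintro rfl
    exact ⟨hr.2.1, hr.2.2.1⟩

/-- A ready node has a unique target, so its departure can be chosen node by node. -/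
lemma Collecting.exists_departures (h : Collecting N s c L fire rank K)
    (hA : ∀ v, N.deg v = 1 → v ∈ A) : ∃ fire', Departures N c fire fire' := by
  have key : ∀ v, ∃ o : Option (V × A), (∀ q, fire v = some q → o = some q) ∧
      (∀ w, Ready N c fire v w → ∃ b, o = some (w, b) ∧ Least N c v b) ∧
      ∀ w b, o = some (w, b) →
        fire v = some (w, b) ∨ (Ready N c fire v w ∧ Least N c v b) := by
    intro v
    by_cases hr : ∃ w, Ready N c fire v w
    · obtain ⟨w, hr⟩ := hr
      obtain ⟨b, e, hb, hmin⟩ := h.exists_least hA hr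
      refine ⟨some (w, b), fun q hq => ?_, fun w' hr' => ?_, fun w' b' hwb => ?_⟩
      · rw [hr.1] at hq; simp at hq
      · obtain rfl := hr.unique hr'
        exact ⟨b, rfl, ⟨e, hb⟩, hmin⟩
      · simp only [Option.some.injEq, Prod.mk.injEq] at hwb
        obtain ⟨rfl, rfl⟩ := hwb
        exact .inr ⟨hr, ⟨e, hb⟩, hmin⟩
    · exact ⟨fire v, fun q hq => hq, fun w hw => absurd ⟨w, hw⟩ hr, fun w b hwb => .inl hwb⟩
  choose fire' h1 h2 h3 using key
  exact ⟨fire', fun {v q} => h1 v q, fun {v w} => h2 v w, fun {v w b} => h3 v w b⟩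

/-- The three possible effects of an activation. -/
inductive Outcome (N : Network V) (c c' : World A Memory) (fire fire' : V → Option (V × A))
    (a : A) : Prop where
  | same (hm : (c'.agent a).mem = (c.agent a).mem) (hp : (c'.agent a).place = (c.agent a).place)
      (hf : ∀ v e, (c.agent a).place = .node v e → (c.agent a).mem.phase = .front →
        fire' v = none)
  | exit (v w : V) (e : Option ℕ) (hr : Ready N c fire v w) (hp : (c.agent a).place = .node v e)
      (hf : fire' v = some (w, a)) (hp' : (c'.agent a).place = .edge v w 0 1)
      (hm : (c'.agent a).mem = ⟨.front, e.toList ++ (c.agent a).mem.trail⟩)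
  | park (v w : V) (e : Option ℕ) (hr : Ready N c fire v w) (hp : (c.agent a).place = .node v e)
      (hp' : (c'.agent a).place = .node v e)
      (hm : (c'.agent a).mem = ⟨.parked, (c.agent a).mem.trail⟩)

/-- The cases are those of the algorithm: two or more missing ports mean waiting, one means leaving
or parking. None is excluded by `hnode`, and meetings inside edges by `hstrict`. -/
lemma Collecting.outcome (h : Collecting N s c L fire rank K)
    (hset : ∀ a, (c.agent a).place.Settled N)
    (hstrict : ∀ {u w a b x y}, fire u = some (w, a) → fire w = some (u, b) →
      (c.agent a).place = .edge u w x 1 → (c.agent b).place = .edge w u y 1 →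
      x + y < N.len u w)
    (hnode : ∀ v, fire v = none → ∃ u, N.graph.Adj u v ∧ ¬ Moved c fire u v)
    (hS : ∀ v w, Ready N c fire v w → ∀ a e, (c.agent a).place = .node v e → a ∈ S)
    (hd : Departures N c fire fire') (a : A) : Outcome N c (c.next N S) fire fire' a := by
  cases hp : (c.agent a).place with
  | node v e =>
    obtain ⟨r, ph, -, -, hm, -, -, ⟨rfl, hf⟩ | ⟨rfl, hf⟩, -⟩ := h.waiting_of_node hp
    · have hfr : (c.agent a).mem.phase = .front := by rw [hm]
      have hmiss := h.missing_eq hset hp hf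
      by_cases hr : ∃ w, Ready N c fire v w
      · obtain ⟨w, hr⟩ := hr
        have haS := hS v w hr a e hp
        have hmiss' := h.missing_of_ready hset hp hr
        obtain ⟨b, hb, ⟨e', he'⟩, hmin⟩ := hd.ready hr
        by_cases hk : ∀ o ∈ c.others N a, (c.reading N a).key ≤ o.2.key
        · obtain ⟨hm', hp'⟩ := next_front_exit haS hp hfr h.not_homeboundAt hr.2.1 hmiss' hk
          have hab : a = b := by
            by_contra hne
            refine hne (h.key_injective hp he' (le_antisymm ?_ (hmin a e hp)))
            exact hk _ (mem_others.2 ⟨b, Ne.symm hne,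
              (coincide_node hset hp).2 ⟨e', he'⟩, rfl⟩)
          subst hab
          exact .exit v w e hr hp hb hp' hm'
        · obtain ⟨hm', hp'⟩ := next_front_park haS hp hfr h.not_homeboundAt ⟨_, hmiss'⟩ hk
          exact .park v w e hr hp hp' hm'
      · obtain ⟨u, hu, hmu⟩ := hnode v hf
        obtain ⟨hm', hp'⟩ := next_front_wait (S := S) hp h.not_homeboundAt
          (by
            rw [hmiss]
            exact Set.Nonempty.ne_empty ⟨_, u, ⟨hu.symm, hmu⟩, rfl⟩)
          (by
            -- With a single missing port the node would be ready.
            rintro ⟨p, hp1⟩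
            refine hr ⟨u, hf, hu.symm, hmu, fun u' hu' hne => ?_⟩
            by_contra hmu'
            have h1 : N.port v u ∈ c.missing N a v := hmiss ▸ ⟨u, ⟨hu.symm, hmu⟩, rfl⟩
            have h2 : N.port v u' ∈ c.missing N a v := hmiss ▸ ⟨u', ⟨hu'.symm, hmu'⟩, rfl⟩
            rw [hp1, Set.mem_singleton_iff] at h1 h2
            exact hne (port_inj hu'.symm hu.symm (h2.trans h1.symm)))
        refine .same hm' (hp'.trans hp.symm) fun v' e' hp1 _ => ?_
        rw [hp] at hp1
        simp only [Place.node.injEq] at hp1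
        rw [← hp1.1]
        cases hf' : fire' v with
        | none => rfl
        | some q =>
          rcases hd.cases (w := q.1) (b := q.2) hf' with hq | ⟨hq, -⟩
          · rw [hf] at hq; simp at hq
          · exact absurd ⟨_, hq⟩ hr
    · obtain ⟨hm', hp'⟩ := next_parked (S := S) hp (by rw [hm]) h.not_homeboundAt
      refine .same hm' (hp'.trans hp.symm) fun v' e' _ hfr => ?_
      rw [hm] at hfr
      simp at hfr
  | edge u w x k =>
    obtain ⟨rfl, hf, h0, h1, hfr, -⟩ := h.moving_of_edge hp
    obtain ⟨hm', hp'⟩ := next_edge (N := N) (S := S) hp fun _ b hb => by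
      have hsa := hset a
      rw [hp] at hsa
      cases hpb : (c.agent b).place with
      | node v' e' =>
        rw [hp, hpb] at hb
        exact absurd hb.symm (not_coincide_node_edge hsa.2.2.1 hsa.2.2.2)
      | edge u' w' y k =>
        obtain ⟨rfl, hfb, -⟩ := h.moving_of_edge hpb
        rw [hp, hpb] at hb
        rcases coincide_edge hsa.2.2.1 hsa.2.2.2 hb with ⟨rfl, rfl, -⟩ | ⟨rfl, rfl, hxy⟩
        · rw [hf] at hfb
          simp only [Option.some.injEq, Prod.mk.injEq, true_and] at hfb
          exact hfb.symm
        · exact absurd hxy (hstrict hf hfb hp hpb).ne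
    refine .same hm' (hp'.trans hp.symm) fun v' e' hp1 _ => ?_
    rw [hp] at hp1
    simp at hp1

/-- All ready nodes fire simultaneously. A departing agent is still on its edge, so no further node
becomes ready in the same round, and `Pending` holds afterwards. -/
lemma Collecting.proceed [Finite V] (h : Collecting N s c L fire rank K) (hG : N.graph.IsTree)
    (hA : ∀ v, N.deg v = 1 → v ∈ A) (hset : ∀ a, (c.agent a).place.Settled N)
    (hstrict : ∀ {u w a b x y}, fire u = some (w, a) → fire w = some (u, b) →
      (c.agent a).place = .edge u w x 1 → (c.agent b).place = .edge w u y 1 →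
      x + y < N.len u w)
    (hnode : ∀ v, fire v = none → ∃ u, N.graph.Adj u v ∧ ¬ Moved c fire u v)
    (hS : ∀ v w, Ready N c fire v w → ∀ a e, (c.agent a).place = .node v e → a ∈ S) :
    ∃ fire' rank' K', Collecting N s (c.next N S) L fire' rank' K' ∧
      Pending N (c.next N S) fire' := by
  obtain ⟨fire', hd⟩ := h.exists_departures hA
  have hout := h.outcome hset hstrict hnode hS hd
  have hedge : ∀ {a u w x}, ((c.next N S).agent a).place = .edge u w x 1 →
      (c.agent a).place = .edge u w x 1 ∨
        (Ready N c fire u w ∧ fire' u = some (w, a) ∧ x = 0) := by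
    intro a u w x hp
    rcases hout a with ⟨-, hp', -⟩ | ⟨v, w', e, hr, -, hf, hp', -⟩ | ⟨v, w', e, -, -, hp', -⟩
    · exact .inl (hp' ▸ hp)
    · rw [hp'] at hp
      simp only [Place.edge.injEq, and_true] at hp
      obtain ⟨rfl, rfl, rfl⟩ := hp
      exact .inr ⟨hr, hf, rfl⟩
    · rw [hp'] at hp
      simp at hp
  have hkeep : ∀ {a u w x}, (c.agent a).place = .edge u w x 1 →
      ((c.next N S).agent a).place = .edge u w x 1 := by
    intro a u w x hp
    rcases hout a with ⟨-, hp', -⟩ | ⟨v, w', e, -, hp', -⟩ | ⟨v, w', e, -, hp', -⟩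
    · exact hp'.trans hp
    · rw [hp] at hp'; simp at hp'
    · rw [hp] at hp'; simp at hp'
  have hexit : ∀ {v w b}, Ready N c fire v w → fire' v = some (w, b) → Least N c v b →
      ((c.next N S).agent b).place = .edge v w 0 1 ∧
        ((c.next N S).agent b).mem.phase = .front := by
    intro v w b hr hf hl
    obtain ⟨⟨e, hp⟩, hmin⟩ := hl
    obtain ⟨r, ph, -, -, hm, -, -, hph, -⟩ := h.waiting_of_node hp
    have hfr : (c.agent b).mem.phase = .front := by
      rcases hph with ⟨rfl, -⟩ | ⟨-, hne⟩
      · rw [hm]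
      · exact absurd hr.1 hne
    rcases hout b with ⟨-, -, hf'⟩ | ⟨v', w', e', hr', hp', hf', hp'', hm'⟩ |
      ⟨v', w', e', hr', hp', hp'', hm'⟩
    · rw [hf' v e hp hfr] at hf
      simp at hf
    · rw [hp] at hp'
      simp only [Place.node.injEq] at hp'
      obtain ⟨rfl, rfl⟩ := hp'
      obtain rfl := hr.unique hr'
      exact ⟨hp'', by rw [hm']⟩
    · exfalso
      rw [hp] at hp'
      simp only [Place.node.injEq] at hp'
      obtain ⟨rfl, rfl⟩ := hp'
      obtain ⟨-, hp3⟩ := next_front_exit (hS v w hr b e hp) hp hfr h.not_homeboundAt hr.2.1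
        (h.missing_of_ready hset hp hr) (by
          intro o ho
          obtain ⟨d, -, hcd, rfl⟩ := mem_others.1 ho
          obtain ⟨e', he'⟩ := (coincide_node hset hp).1 hcd
          exact hmin d e' he')
      rw [hp3] at hp''
      simp at hp''
  have hmoved : ∀ {u v}, Moved c fire u v → Moved (c.next N S) fire' u v := by
    rintro u v ⟨b, hb, hne⟩
    refine ⟨b, hd.mono hb, fun x hx => ?_⟩
    rcases hedge hx with hx | ⟨hr, -⟩
    · exact hne x hx
    · rw [hr.1] at hb
      simp at hb
  have hnotmoved : ∀ {u v}, ¬ Moved c fire u v → ¬ Moved (c.next N S) fire' u v := by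
    rintro u v hn ⟨b, hb, hne⟩
    rcases hd.cases hb with hb' | ⟨hr, hl⟩
    · refine hn ⟨b, hb', fun x hx => hne x (hkeep hx)⟩
    · exact hne 0 (hexit hr hb hl).1
  have hopp : ∀ {u w a b}, fire' u = some (w, a) → fire' w = some (u, b) →
      ∃ x y, ((c.next N S).agent a).place = .edge u w x 1 ∧
        ((c.next N S).agent b).place = .edge w u y 1 ∧ x + y < N.len u w := by
    -- If w fired earlier towards u and u is only now ready to fire towards w, the carrier from w
    -- cannot have arrived; it is strictly inside the reach of the edge.
    have half : ∀ {u w a b}, Ready N c fire u w → fire' u = some (w, a) → Least N c u a →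
        fire w = some (u, b) → ∃ y, ((c.next N S).agent a).place = .edge u w 0 1 ∧
          ((c.next N S).agent b).place = .edge w u y 1 ∧ y < N.len w u := by
      intro u w a b hr hfu hl hfw
      have : ∃ y, (c.agent b).place = .edge w u y 1 := by
        by_contra! hno
        exact hr.2.2.1 ⟨b, hfw, hno⟩
      obtain ⟨y, hy⟩ := this
      obtain ⟨-, -, -, hy1, -⟩ := h.moving_of_edge hy
      exact ⟨y, (hexit hr hfu hl).1, hkeep hy, hy1⟩
    intro u w a b hfu hfw
    rcases hd.cases hfu with hfu' | ⟨hru, hlu⟩ <;> rcases hd.cases hfw with hfw' | ⟨hrw, hlw⟩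
    · obtain ⟨x, y, ha, hb, -⟩ := h.opposite hfu' hfw'
      exact ⟨x, y, hkeep ha, hkeep hb, hstrict hfu' hfw' ha hb⟩
    · obtain ⟨y, ha, hb, hy⟩ := half hrw hfw hlw hfu'
      exact ⟨y, 0, hb, ha, by linarith⟩
    · obtain ⟨y, ha, hb, hy⟩ := half hru hfu hlu hfw'
      rw [N.len_symm] at hy
      exact ⟨0, y, ha, hb, by linarith⟩
    · refine ⟨0, 0, (hexit hru hfu hlu).1, (hexit hrw hfw hlw).1, ?_⟩
      linarith [N.len_pos _ _ hru.2.1]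
  have hphase : ∀ a, (c.agent a).mem.phase = .front ∨ (c.agent a).mem.phase = .parked := by
    intro a
    rcases h.state a with ⟨v, r, ph, -, -, hm, -, -, hph, -⟩ | ⟨u, w, x, r, -, -, hm, -⟩
    · rw [hm]
      exact hph.imp And.left And.left
    · exact .inl (by rw [hm])
  have hrank : ∀ a, rank a ≤ K := fun a =>
    (hphase a).elim (fun hf => (h.rank_front a hf).le) fun hp => (h.rank_parked a hp).le
  classical
  -- K counts rounds: agents parked in this round keep the rank K, whereas those that remain in
  -- front, in particular the carrier of the same node, advance to K + 1.
  refine ⟨fire', fun a => if ((c.next N S).agent a).mem.phase = .front then K + 1 else rank a,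
    K + 1, ⟨fun a => timer_next (h.timer a), fun a => (h.chain a).imp fun y x hyx => hd.mono hyx,
      h.last, h.nodup, fun a => ?_, fun {v w b} hf => ?_, fun {v w b} hf u hu hne => ?_,
      fun {v w b} hf => ?_, fun hu hw => ?_, fun a ha => ?_, fun a ha => ?_,
      fun {a v e w b} hp hf => ?_, ?_⟩,
    ⟨fun {v} hf => ?_, fun {u w a b x y} hfu hfw ha hb => ?_⟩⟩
  · rcases hout a with ⟨hm', hp', hf'⟩ | ⟨v, w, e, hr, hp, hf', hp', hm'⟩ |
      ⟨v, w, e, hr, hp, hp', hm'⟩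
    · rcases h.state a with ⟨v, r, ph, hp, hL, hm, hu, hD, hph, hnear⟩ |
        ⟨u, w, x, r, hp, hL, hm, hf, h0, h1, hu, hD, hnear⟩
      · refine .inl ⟨v, r, ph, hp'.trans hp, hL, hm'.trans hm, ?_⟩
        rw [used_next]
        refine ⟨hu, hD, ?_, hnear⟩
        rcases hph with ⟨rfl, hf⟩ | ⟨rfl, hf⟩
        · exact .inl ⟨rfl, hf' v _ hp (by rw [hm])⟩
        · exact .inr ⟨rfl, fun hn => hf (hd.eq_none hn).1⟩
      · refine .inr ⟨u, w, x, r, hp'.trans hp, hL, hm'.trans hm, hd.mono hf, h0, h1, ?_⟩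
        rw [used_next]
        exact ⟨hu, hD, hnear⟩
    · obtain ⟨r, ph, rfl, hL, hm, hu, hD, hph, hnear⟩ := h.waiting_of_node hp
      obtain ⟨b, hb, -, hmin⟩ := hd.ready hr
      rw [hf'] at hb
      simp only [Option.some.injEq, Prod.mk.injEq, true_and] at hb
      subst hb
      have hused : ∀ d e, (c.agent d).place = .node v e → (c.agent a).used ≤ (c.agent d).used := by
        intro d e hde
        have hk := hmin d e hde
        rw [Reading.key, Reading.key, Prod.Lex.toLex_le_toLex] at hk
        rcases hk with hk | hk
        · exact hk.le
        · exact hk.1.le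
      have hnear' : ∀ x ∈ A, x ∈ side N.graph v w → ∀ p : N.graph.Walk x v,
          N.wayLen (v :: r) ≤ N.walkLen p := by
        intro x hxA hx p
        rw [← hu]
        -- An agent that starts at v is still there and has used nothing, so the least agent has
        -- used nothing either. Otherwise x is behind some neighbour u other than w, and the agent
        -- that came from u has used at least as much as the least one.
        by_cases hxv : x = v
        · subst hxv
          obtain ⟨hL', hp'⟩ := h.place_start (a := ⟨x, hxA⟩) hr.1
          obtain ⟨r', -, -, hL'', -, hu', -⟩ := h.waiting_of_node hp'
          rw [hL', List.cons.injEq] at hL''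
          rw [← hL''.2] at hu'
          have := hused _ _ hp'
          rw [hu'] at this
          exact (this.trans_eq rfl).trans (walkLen_nonneg p)
        · obtain ⟨u, hu1, huw, hxu⟩ := exists_side_of_mem_side hx hxv
          obtain ⟨d, r', hLd, hpd⟩ := h.exists_of_moved (hr.2.2.2 u hu1 huw) hr.1
          obtain ⟨r'', -, -, hLd', -, -, -, -, hneard⟩ := h.waiting_of_node hpd
          rw [hLd, List.cons.injEq] at hLd'
          refine (hused _ _ hpd).trans (hneard u ?_ x hxA hxu p)
          rw [← hLd'.2]
          rfl
      refine .inr ⟨v, w, 0, r, hp', hL, ?_, hf', le_rfl, N.len_pos _ _ hr.2.1, ?_,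
        add_len_le_sep hG hA hr.2.1 hnear', hnear'⟩
      · rw [hm', hm, exits_cons]
      · rw [used_next, hu, add_zero]
    · obtain ⟨r, ph, rfl, hL, hm, hu, hD, hph, hnear⟩ := h.waiting_of_node hp
      refine .inl ⟨v, r, .parked, hp', hL, by rw [hm', hm], ?_⟩
      rw [used_next]
      refine ⟨hu, hD, .inr ⟨rfl, fun hn => (hd.eq_none hn).2 w hr⟩, hnear⟩
  · rcases hd.cases hf with hf | ⟨hr, -⟩
    · exact h.adj hf
    · exact hr.2.1
  · rcases hd.cases hf with hf | ⟨hr, -⟩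
    · exact hmoved (h.moved hf u hu hne)
    · exact hmoved (hr.2.2.2 u hu hne)
  · rcases hd.cases hf with hf' | ⟨hr, hl⟩
    · rcases h.trace hf' with ⟨x, hx⟩ | ht
      · exact .inl ⟨x, hkeep hx⟩
      · exact .inr ht
    · exact .inl ⟨0, (hexit hr hf hl).1⟩
  · obtain ⟨x, y, ha, hb, hxy⟩ := hopp hu hw
    exact ⟨x, y, ha, hb, hxy.le⟩
  · rw [if_neg (by rw [ha]; simp)]
    exact Nat.lt_succ_of_le (hrank a)
  · rw [if_pos ha]
  · have hna : ((c.next N S).agent a).mem.phase ≠ .front := by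
      intro hfr
      rcases hout a with ⟨hm', hp', hf'⟩ | ⟨v', w', e', hr, -, -, hp', -⟩ |
        ⟨v', w', e', hr, -, hp', hm'⟩
      · rw [hm'] at hfr
        rw [hp'] at hp
        rw [hf' v e hp hfr] at hf
        simp at hf
      · rw [hp'] at hp
        simp at hp
      · rw [hm'] at hfr
        simp at hfr
    rw [if_neg hna]
    rcases hd.cases hf with hf' | ⟨hr, hl⟩
    · have hpa : (c.agent a).place = .node v e := by
        rcases hout a with ⟨-, hp', -⟩ | ⟨v', w', e', -, -, -, hp', -⟩ |
          ⟨v', w', e', -, hp0, hp', -⟩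
        · exact hp' ▸ hp
        · rw [hp'] at hp
          simp at hp
        · exact hp0.trans (hp'.symm.trans hp)
      have := h.rank_wait hpa hf'
      have := hrank b
      split_ifs <;> omega
    · rw [if_pos (hexit hr hf hl).2]
      exact Nat.lt_succ_of_le (hrank a)
  · obtain ⟨a, ha, hs⟩ := h.known
    rcases hout a with ⟨hm', -, -⟩ | ⟨v, w, e, hr, -, -, hp', hm'⟩ | ⟨v, w, e, hr, hp, hp', hm'⟩
    · exact ⟨a, by rw [hm', ha], mem_known_next hs⟩
    · exact ⟨a, by rw [hm'], mem_known_next hs⟩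
    -- The informed agent parks, but it shares its information with the agent that leaves the same
    -- node.
    · obtain ⟨b, hb, hl⟩ := hd.ready hr
      refine ⟨b, (hexit hr hb hl).2, ?_⟩
      rw [known_next]
      obtain ⟨e', he'⟩ := hl.1
      exact ⟨a, (coincide_node hset he').2 ⟨e, hp⟩, hs⟩
  · obtain ⟨hf0, hnr⟩ := hd.eq_none hf
    obtain ⟨u, hu, hmu⟩ := hnode v hf0
    have : ∃ u', N.graph.Adj u' v ∧ u' ≠ u ∧ ¬ Moved c fire u' v := by
      by_contra! hno
      exact hnr u ⟨hf0, hu.symm, hmu, hno⟩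
    obtain ⟨u', hu', hne, hmu'⟩ := this
    exact ⟨u', u, hne, hu', hu, hnotmoved hmu', hnotmoved hmu⟩
  · obtain ⟨x', y', ha', hb', hlt⟩ := hopp hfu hfw
    rw [ha] at ha'
    rw [hb] at hb'
    simp only [Place.edge.injEq, and_true, true_and] at ha' hb'
    subst ha' hb'
    exact hlt

end Proceed

section Main

variable {V : Type*} {N : Network V} {A : Finset V} {c : World A Memory} {S : Set A}
  {v w s : V} {e : Option ℕ} {δ : ℝ}
  {fire : V → Option (V × A)} {L : A → List V} {rank : A → ℕ} {K : ℕ}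

/-! ### The whole execution -/

/-- An activation of the agents at all nodes to which information has come from all sides but at
most one. -/
lemma Collecting.respond [Finite V] (h : Collecting N s c L fire rank K) (hG : N.graph.IsTree)
    (hA : ∀ v, N.deg v = 1 → v ∈ A) (hset : ∀ a, (c.agent a).place.Settled N)
    (hstrict : ∀ {u w a b x y}, fire u = some (w, a) → fire w = some (u, b) →
      (c.agent a).place = .edge u w x 1 → (c.agent b).place = .edge w u y 1 →
      x + y < N.len u w)
    (hS : ∀ v w, fire v = none → (∀ u, N.graph.Adj u v → u ≠ w → Moved c fire u v) →
      ∀ a e, (c.agent a).place = .node v e → a ∈ S) :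
    (∃ t rank', Returning N (2 * N.sep A) s (c.next N S) t rank') ∨
    ∃ fire' rank' K', Collecting N s (c.next N S) L fire' rank' K' ∧
      Pending N (c.next N S) fire' := by
  by_cases hnode : ∀ v, fire v = none → ∃ u, N.graph.Adj u v ∧ ¬ Moved c fire u v
  · exact .inr (h.proceed hG hA hset hstrict hnode fun v w hr => hS v w hr.1 hr.2.2.2)
  · push Not at hnode
    obtain ⟨v, hf, hall⟩ := hnode
    -- Here no neighbour is missing, so v serves as a dummy for the exceptional neighbour.
    exact .inl (h.turn_at_node hG hset hf hall (hS v v hf fun u hu _ => hall u hu))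

/-- A meeting inside an edge ends the collection. Any other event includes an arrival, which
lengthens some list. -/
lemma Collecting.step [Finite V] (h : Collecting N s c L fire rank K) (hG : N.graph.IsTree)
    (hA : ∀ v, N.deg v = 1 → v ∈ A) (hpd : Pending N c fire) (hδ : c.NextEvent N δ) :
    (∃ t rank', Returning N (2 * N.sep A) s ((c.advance N δ).next N (c.activated N δ)) t rank') ∨
    ∃ L' fire' rank' K',
      Collecting N s ((c.advance N δ).next N (c.activated N δ)) L' fire' rank' K' ∧
      Pending N ((c.advance N δ).next N (c.activated N δ)) fire' ∧
      ∑ a, (L a).length < ∑ a, (L' a).length := by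
  have hadv := h.advance hG.isAcyclic hpd hδ
  have hset := settled_advance h.regular hδ
  by_cases hmeet : ∃ a b u w x y, (c.agent a).place = .edge u w x 1 ∧
      (c.agent b).place = .edge w u y 1 ∧ x + y + 2 * δ = N.len u w
  · left
    obtain ⟨a, b, u, w, x, y, ha, hb, hxy⟩ := hmeet
    obtain ⟨-, hfa, hx0, -⟩ := h.moving_of_edge ha
    obtain ⟨-, hfb, hy0, -⟩ := h.moving_of_edge hb
    have hlt := hpd.strict hfa hfb ha hb
    have hpos := hδ.1.1
    obtain ⟨hta, htb⟩ := triggered_of_meet (h.adj hfa).ne ha hb hx0 hy0 hlt hxy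
    refine hadv.turn_at_edge hG (place_advance_edge ha fun hx => by linarith)
      (place_advance_edge hb fun hy => ?_) (by linarith) (mem_activated hta) (mem_activated htb)
    rw [N.len_symm] at hy
    linarith
  · have hresp := hadv.respond (S := c.activated N δ) hG hA hset
      (fun {u w a b x y} hfu hfw ha hb => by
        obtain ⟨x', ha', rfl, -⟩ := place_of_advance_edge h.regular ha
        obtain ⟨y', hb', rfl, -⟩ := place_of_advance_edge h.regular hb
        have hle := nextEvent_le_meet h.regular hδ ha' hb' (hpd.strict hfu hfw ha' hb')
        refine lt_of_le_of_ne (by linarith) fun heq => hmeet ⟨a, b, u, w, x', y', ha', hb', ?_⟩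
        linarith)
      (fun v w hf hall a e ha => by
        -- Before the event two neighbours were missing at v, so at least one other than w was
        -- supplied by an arrival at this very moment, which activates all agents at v.
        obtain ⟨u₁, u₂, hne, h₁, h₂, hm₁, hm₂⟩ := hpd.missing hf
        obtain ⟨u, huw, hu, hmu⟩ : ∃ u, u ≠ w ∧ N.graph.Adj u v ∧ ¬ Moved c fire u v := by
          by_cases hu : u₁ = w
          · exact ⟨u₂, fun h => hne (hu.trans h.symm), h₂, hm₂⟩
          · exact ⟨u₁, hu, h₁, hm₁⟩
        obtain ⟨b, hb, hnb⟩ := hall u hu huw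
        have : ∃ x, (c.agent b).place = .edge u v x 1 := by
          by_contra! hno
          exact hmu ⟨b, hb, hno⟩
        obtain ⟨x, hx⟩ := this
        by_cases hxδ : x + δ = N.len u v
        · exact mem_activated_of_arrival hx hxδ ha
        · exact absurd (place_advance_edge hx hxδ) (hnb _))
    refine hresp.imp id fun ⟨fire', rank', K', hc', hp'⟩ => ⟨_, fire', rank', K', hc', hp', ?_⟩
    obtain ⟨b, u, w, x, hb, hx⟩ := (nextEvent_cases h.regular hδ).resolve_right hmeet
    refine Finset.sum_lt_sum (fun a _ => ?_) ⟨b, Finset.mem_univ _, ?_⟩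
    · rcases visited_eq (N := N) (δ := δ) (l := L a) (c.agent a).place with hv | ⟨w, hv⟩
      · rw [hv]
      · rw [hv, List.length_cons]
        omega
    · rw [hb, visited_arrival hx, List.length_cons]
      omega

/-- Lists without repetition have total length at most |A| · |V|, so arrivals cannot go on forever.
-/
theorem Collecting.terminates [Finite V] (h : Collecting N s c L fire rank K)
    (hG : N.graph.IsTree) (hA : ∀ v, N.deg v = 1 → v ∈ A) (hpd : Pending N c fire) :
    ∃ c' : World A Memory, Relation.ReflTransGen (gather.Step N) c c' ∧ c'.Quiescent ∧
      ∀ a, s ∈ (c'.agent a).known ∧ (c'.agent a).used ≤ 2 * N.sep A := by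
  have hbound : ∀ {c : World A Memory} {L fire rank K}, Collecting N s c L fire rank K →
      ∑ a, (L a).length ≤ Fintype.card A * Nat.card V := by
    intro c L fire rank K h
    have := Fintype.ofFinite V
    rw [← smul_eq_mul, ← Finset.card_univ]
    refine Finset.sum_le_card_nsmul _ _ _ fun a _ => ?_
    rw [Nat.card_eq_fintype_card]
    exact (h.nodup a).length_le_card
  generalize hn : Fintype.card A * Nat.card V - ∑ a, (L a).length = n
  induction n using Nat.strong_induction_on generalizing c L fire rank K with
  | _ n ih =>
    obtain ⟨a, u, w, x, hp⟩ := h.exists_moving hG.isAcyclic hpd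
    obtain ⟨δ, hδ⟩ := exists_nextEvent h.regular hp
    rcases h.step hG hA hpd hδ with ⟨t, rank', hr⟩ | ⟨L', fire', rank', K', h', hpd', hlt⟩
    · obtain ⟨c', hc', hrest⟩ := hr.terminates
      exact ⟨c', .head (step_of_nextEvent hδ) hc', hrest⟩
    · obtain ⟨c', hc', hrest⟩ := ih _ (by
        have := hbound h'
        omega) h' hpd' rfl
      exact ⟨c', .head (step_of_nextEvent hδ) hc', hrest⟩

/-- The agents at their starting nodes, before the first activation. -/
def World.start (A : Finset V) : World A Memory where
  time := 0
  agent a := ⟨⟨.front, []⟩, .node a none, none, 0, {↑a}⟩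

lemma collecting_start (N : Network V) (s : A) :
    Collecting N (s : V) (World.start A) (fun a => [(a : V)]) (fun _ => none) (fun _ => 0) 0 where
  timer _ := rfl
  chain _ := List.isChain_singleton _
  last _ := rfl
  nodup _ := List.nodup_singleton _
  state a := .inl ⟨a, [], .front, rfl, rfl, rfl, rfl, sep_nonneg, .inl ⟨rfl, rfl⟩, by simp⟩
  adj h := by simp at h
  moved h := by simp at h
  trace h := by simp at h
  opposite h := by simp at h
  rank_parked a h := by simp [World.start] at h
  rank_front _ _ := rfl
  rank_wait _ h := by simp at h
  known := ⟨s, rfl, rfl⟩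

theorem gather_terminates [Finite V] (s : A) (hG : N.graph.IsTree)
    (hA : ∀ v, N.deg v = 1 → v ∈ A) :
    ∃ c : World A Memory, gather.EndsIn N c ∧
      ∀ a, (s : V) ∈ (c.agent a).known ∧ (c.agent a).used ≤ 2 * N.sep A := by
  have key : ∃ c : World A Memory,
      Relation.ReflTransGen (gather.Step N) ((World.start A).next N Set.univ) c ∧ c.Quiescent ∧
      ∀ a, (s : V) ∈ (c.agent a).known ∧ (c.agent a).used ≤ 2 * N.sep A := by
    rcases (collecting_start N s).respond (S := Set.univ) hG hA (fun a => trivial)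
      (fun h => by simp at h) (fun _ _ _ _ _ _ _ => trivial) with
      ⟨t, rank, h⟩ | ⟨fire, rank, K, h, hpd⟩
    · exact h.terminates
    · exact h.terminates hG hA hpd
  obtain ⟨c, hc, hq, hrest⟩ := key
  -- By definition, `gather.initial N A` is the response of all agents in `World.start A`.
  exact ⟨c, ⟨hc, hq⟩, hrest⟩

end Main

end MobileAgents

theorem mainTheorem7 :
    ∃ alg : MobileAgents.Algorithm,
      ∀ (V : Type*) [Finite V] (N : MobileAgents.Network V) (A : Finset V) (s : A),
        N.graph.IsTree → (∀ v, N.deg v = 1 → v ∈ A) →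
        ∃ c : MobileAgents.World A alg.Mem, alg.EndsIn N c ∧
          (∀ a, (s : V) ∈ (c.agent a).known) ∧
          (∀ a, (c.agent a).used ≤ 2 * N.sep A) ∧
          (∀ P, MobileAgents.HasBroadcastStrategy N A s P → ∀ a, (c.agent a).used ≤ 4 * P) := by
  refine ⟨MobileAgents.gather, fun V _ N A s hG hA => ?_⟩
  obtain ⟨c, hc, h⟩ := MobileAgents.gather_terminates s hG hA
  refine ⟨c, hc, fun a => (h a).1, fun a => (h a).2, fun P hP a => (h a).2.trans ?_⟩
  linarith [MobileAgents.sep_le_two_mul hG.connected hP]
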